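/- All graphs are finite and simple. A graph is hypohamiltonian if it is non-hamiltonian but all its vertex-deleted subgraphs are hamiltonian. A pair $(v,w)$ of vertices is good in a graph if the graph has a hamiltonian path with end-vertices $v$ and $w$; a pair of pairs $((v,w),(v',w'))$ is good if there are two disjoint paths which together span the graph, with end-vertices $v,w$ and $v',w'$, respectively. Let $G$ be a non-hamiltonian graph having two edges $ab$ and $cd$ without common vertex such that (i) each of $(a,c)$, $(a,d)$, $(b,c)$, $(b,d)$, $((a,b),(c,d))$ is good in $G-\{ab,cd\}$; (ii) for each vertex $v$ of $G$, at least one of $(a,b)$ and $(c,d)$ is good in $G-\{v,ab,cd\}$ (in particular, both vertices of that pair differ from $v$). Let $H$ be a hypohamiltonian graph, disjoint from $G$, with adjacent cubic vertices $x$ and $y$. For a labelling $N_H(x)=\{a',b',y\}$, $N_H(y)=\{c',d',x\}$ of the neighbours of $x$ and $y$, the dot product $G\cdot H$ is the graph obtained from the disjoint union of $G-\{ab,cd\}$ and $H-\{x,y\}$ by adding the edges $aa',bb',cc',dd'$. Then, for every such labelling, $G\cdot H$ is hypohamiltonian; the girth of $G\cdot H$ is at least $\min\{g,h\}$, where $g$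 and $h$ are the girths of $G$ and $H$; and if $G$ and $H$ are cubic, then so is $G\cdot H$. Moreover, if $G$ and $H$ are planar and $G$ has a plane embedding in which $ab$ and $cd$ lie on the boundary of a common face, then the labelling can be chosen such that $G\cdot H$ is planar. (Plane embeddings are given combinatorially: by the cyclic order of the edges around each vertex, such that Euler's formula $|V|-|E|+|F|=2$ holds for each connected component, where the faces are the facial boundary walks.) -/

import Mathlib

namespace SimpleGraph

section Hamiltonicity

variable {V : Type*}

open scoped Classical in
/-- A finite graph is hypohamiltonian if it is not hamiltonian, but deleting any one vertex
leaves a hamiltonian graph. -/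
def IsHypohamiltonian [Fintype V] (G : SimpleGraph V) : Prop :=
  ¬ G.IsHamiltonian ∧ ∀ v : V, (G.induce {u | u ≠ v}).IsHamiltonian

open scoped Classical in
/-- The pair `(v, w)` is good in `G`: there is a hamiltonian path of `G` with end-vertices
`v` and `w`. -/
def IsGoodPair (G : SimpleGraph V) (v w : V) : Prop :=
  ∃ p : G.Walk v w, p.IsHamiltonian

/-- The pair of pairs `((v, w), (x, y))` is good in `G`: there are two disjoint paths, with
end-vertices `v, w` and `x, y` respectively, which together span `G`. -/
def IsGoodPairOfPairs (G : SimpleGraph V) (v w x y : V) : Prop :=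
  ∃ (p : G.Walk v w) (q : G.Walk x y), p.IsPath ∧ q.IsPath ∧
    p.support.Disjoint q.support ∧ ∀ u : V, u ∈ p.support ∨ u ∈ q.support

/-- The pair `(v, w)` is good in `G - z`. In particular `v` and `w` are vertices of `G - z`. -/
def IsGoodPairAfterDelete (G : SimpleGraph V) (z v w : V) : Prop :=
  ∃ (hv : v ≠ z) (hw : w ≠ z), (G.induce {u | u ≠ z}).IsGoodPair ⟨v, hv⟩ ⟨w, hw⟩

/-- The vertex `v` is cubic in `G`. -/
def IsCubicVertex (G : SimpleGraph V) (v : V) : Prop :=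
  (G.neighborSet v).ncard = 3

/-- The graph `G` is cubic. -/
def IsCubic (G : SimpleGraph V) : Prop :=
  ∀ v : V, G.IsCubicVertex v

end Hamiltonicity

section DotProduct

variable {V W : Type*}

/-- For adjacent cubic vertices `x`, `y` of `H`: the other two neighbours of `x` are `a', b'`
and the other two neighbours of `y` are `c', d'`. -/
def AreOtherNeighbors (H : SimpleGraph W) (x y a' b' c' d' : W) : Prop :=
  H.neighborSet x = {a', b', y} ∧ H.neighborSet y = {c', d', x}

/-- The dot product: the disjoint union of `G - {ab, cd}` and `H - {x, y}` together with the
four edges `aa'`, `bb'`, `cc'`, `dd'`. -/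
def dotProduct (G : SimpleGraph V) (H : SimpleGraph W) (a b c d : V) (x y a' b' c' d' : W) :
    SimpleGraph (V ⊕ {w : W | w ≠ x ∧ w ≠ y}) :=
  ((G.deleteEdges {s(a, b), s(c, d)}) ⊕g (H.induce {w : W | w ≠ x ∧ w ≠ y})) ⊔
    SimpleGraph.fromRel fun p q =>
      ∃ (u : V) (w : {w : W | w ≠ x ∧ w ≠ y}), p = Sum.inl u ∧ q = Sum.inr w ∧
        ((u = a ∧ w.1 = a') ∨ (u = b ∧ w.1 = b') ∨ (u = c ∧ w.1 = c') ∨ (u = d ∧ w.1 = d'))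

end DotProduct

section Planarity

variable {V : Type*}

/-- A combinatorial embedding (rotation system) of a graph: for every vertex, a cyclic order of
the darts leaving that vertex. -/
structure RotationSystem (G : SimpleGraph V) where
  /-- The next dart in the rotation at the initial vertex. -/
  next : Equiv.Perm G.Dart
  /-- The cycles of `next` are exactly the sets of darts leaving a common vertex. -/
  sameCycle_iff : ∀ d e : G.Dart, next.SameCycle d e ↔ d.fst = e.fst

namespace RotationSystem

variable {G : SimpleGraph V}

/-- One step along a facial boundary walk: traverse the dart `d` and leave its end-vertex along
the dart that follows the reverse of `d` in the rotation there. -/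
def faceStep (R : G.RotationSystem) : Equiv.Perm G.Dart :=
  (Function.Involutive.toPerm (Dart.symm (G := G)) Dart.symm_involutive).trans R.next

/-- The facial boundary walks of the embedding, as cycles of darts. -/
def Face (R : G.RotationSystem) : Type _ :=
  Quotient (Equiv.Perm.SameCycle.setoid R.faceStep)

/-- The combinatorial embedding is plane, that is, of Euler genus zero: every connected component
satisfies `#vertices - #edges + #faces = 2`. As no component can exceed the value `2`, this is
expressed by summing over all components; an isolated vertex carries no dart, so that its one
face has to be counted separately. -/
def IsPlane [Finite V] (R : G.RotationSystem) : Prop :=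
  Nat.card V + (Nat.card R.Face + Nat.card {v : V // ∀ w, ¬ G.Adj v w}) =
    Nat.card G.edgeSet + 2 * Nat.card G.ConnectedComponent

/-- The edges `e` and `f` lie on the boundary walk of a common face. -/
def OnCommonFace (R : G.RotationSystem) (e f : Sym2 V) : Prop :=
  ∃ d₁ d₂ : G.Dart, d₁.edge = e ∧ d₂.edge = f ∧ R.faceStep.SameCycle d₁ d₂

end RotationSystem

/-- A finite graph is planar if it has a plane embedding. -/
def IsPlanar [Finite V] (G : SimpleGraph V) : Prop :=
  ∃ R : G.RotationSystem, R.IsPlane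

end Planarity

end SimpleGraph

/-! A cycle of the dot product crosses between the two sides only along the four new edges. If it
crosses twice, it is a path of `G` and a path of `H`. When the path of `G` ends at `a` and `b`, or
at `c` and `d`, the deleted edge closes it in `G`; otherwise the path of `H` leads from a neighbour
of `x` to one of `y` and is closed through the edge `xy`. If it crosses four times, there are two
paths on each side, and either `ab` and `cd` join the two paths of `G` to a cycle, or `x` and `y`
join the two paths of `H` to one. The new cycle is no longer than the old one and spans its factor
if the old one spans the dot product. This is `HasCycleOn.of_dotProduct`; it gives both
non-hamiltonicity and the girth bound.

For a deleted vertex the argument runs backwards. A hamiltonian cycle of `H - y` passes through `x`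
and hence yields a hamiltonian path of `H - {x, y}` from `a'` to `b'`; condition (ii) supplies the
matching path of `G`. A hamiltonian cycle of `H - v` with `v` different from `x` and `y` yields
either one path or two, according to whether it uses `xy`, and condition (i) has a counterpart for
each possibility (`AreOtherNeighbors.exists_paths`).

For cubicity and planarity, the dart from `a` to `a'` takes the place of the dart from `a` to `b`,
and its reverse takes the place of the dart from `a'` to `x`; the other new edges are treated alike.
So the darts of the dot product are those of `G` and those of `H` that leave neither `x` nor `y`,
with the same initial vertices (`IsDotData.dartEquiv`). Degrees are kept and the rotations of the
factors can be reused; only the reversal of darts changes. The old and the new reversal differ by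
five transpositions, each changing the number of cycles of the face permutation by at most one;
because `ab` and `cd` share a face, one of them splits a cycle, so at most three faces are lost
(`cycleCount_mul_unsplice_le`). That many faces already force the value two in Euler's formula,
since every rotation system satisfies the inequality `card_add_card_face_le`. -/

namespace SimpleGraph

/-! ### Paths and cycles as vertex lists and vertex sets -/

section PathsOn

variable {V W : Type*} {G G' : SimpleGraph V} {H : SimpleGraph W}

/-- The list `l` runs through the vertices of a path of `G` from `v` to `w`. -/
def IsPathList (G : SimpleGraph V) (l : List V) (v w : V) : Prop :=
  l.IsChain G.Adj ∧ l.Nodup ∧ l.head? = some v ∧ l.getLast? = some w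

/-- There is a path of `G` from `v` to `w` with vertex set `S`. -/
def HasPathOn (G : SimpleGraph V) (S : Set V) (v w : V) : Prop :=
  ∃ l, G.IsPathList l v w ∧ ∀ u, u ∈ l ↔ u ∈ S

/-- There is a cycle of `G` with vertex set `S`. -/
def HasCycleOn (G : SimpleGraph V) (S : Set V) : Prop :=
  ∃ v w, G.HasPathOn S v w ∧ G.Adj w v ∧ 3 ≤ S.ncard

lemma isPathList_singleton (v : V) : G.IsPathList [v] v v := by
  simp [IsPathList]

lemma IsPathList.reverse {l : List V} {v w : V} (h : G.IsPathList l v w) :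
    G.IsPathList l.reverse w v := by
  obtain ⟨h1, h2, h3, h4⟩ := h
  refine ⟨?_, by simpa using h2, by simpa using h4, by simpa using h3⟩
  rw [List.isChain_reverse]
  exact h1.imp fun _ _ h => G.adj_symm h

lemma IsPathList.append {l m : List V} {v w u z : V} (h : G.IsPathList l v w)
    (h' : G.IsPathList m u z) (hwu : G.Adj w u) (hd : l.Disjoint m) :
    G.IsPathList (l ++ m) v z := by
  obtain ⟨h1, h2, h3, h4⟩ := h
  obtain ⟨k1, k2, k3, k4⟩ := h'
  refine ⟨List.isChain_append.2 ⟨h1, k1, ?_⟩, List.nodup_append'.2 ⟨h2, k2, hd⟩, ?_, ?_⟩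
  · intro a ha b hb
    rw [h4] at ha; rw [k3] at hb
    simp only [Option.mem_def, Option.some.injEq] at ha hb
    subst ha; subst hb; exact hwu
  · simp [List.head?_append, h3]
  · simp [List.getLast?_append, k4]

lemma IsPathList.of_append {l m : List V} {v z : V} (h : G.IsPathList (l ++ m) v z)
    (hl : l ≠ []) (hm : m ≠ []) :
    ∃ w u, G.IsPathList l v w ∧ G.IsPathList m u z ∧ G.Adj w u ∧ l.Disjoint m := by
  obtain ⟨h1, h2, h3, h4⟩ := h
  obtain ⟨c1, c2, c3⟩ := List.isChain_append.1 h1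
  obtain ⟨d1, d2, d3⟩ := List.nodup_append'.1 h2
  have hw := List.getLast?_eq_some_getLast hl
  have hu := List.head?_eq_some_head hm
  refine ⟨_, _, ⟨c1, d1, ?_, hw⟩, ⟨c2, d2, hu, ?_⟩, c3 _ hw _ hu, d3⟩
  · rw [List.head?_append_of_ne_nil _ hl] at h3; exact h3
  · rw [List.getLast?_append_of_ne_nil _ hm] at h4; exact h4

lemma IsPathList.map {l : List V} {v w : V} (h : G.IsPathList l v w) {f : V → W}
    (hf : ∀ a ∈ l, ∀ b ∈ l, G.Adj a b → H.Adj (f a) (f b)) (hinj : Function.Injective f) :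
    H.IsPathList (l.map f) (f v) (f w) := by
  obtain ⟨h1, h2, h3, h4⟩ := h
  refine ⟨?_, h2.map hinj, by simp [h3], by simp [h4]⟩
  rw [List.isChain_map]
  exact h1.imp_of_mem_imp (fun a b ha hb hab => hf a ha b hb hab)

lemma IsPathList.of_map {l : List V} {v w : W} {f : V → W}
    (h : H.IsPathList (l.map f) v w) (hf : ∀ a b, H.Adj (f a) (f b) → G.Adj a b) :
    ∃ v' w', v = f v' ∧ w = f w' ∧ G.IsPathList l v' w' := by
  obtain ⟨h1, h2, h3, h4⟩ := h
  rw [List.isChain_map] at h1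
  simp only [List.head?_map, Option.map_eq_some_iff, List.getLast?_map] at h3 h4
  obtain ⟨v', hv, rfl⟩ := h3
  obtain ⟨w', hw, rfl⟩ := h4
  exact ⟨v', w', rfl, rfl, h1.imp hf, h2.of_map, hv, hw⟩

lemma IsPathList.left_mem {l : List V} {v w : V} (h : G.IsPathList l v w) : v ∈ l :=
  List.mem_of_mem_head? h.2.2.1

lemma IsPathList.right_mem {l : List V} {v w : V} (h : G.IsPathList l v w) : w ∈ l :=
  List.mem_of_mem_getLast? h.2.2.2

lemma IsPathList.eq_singleton {l : List V} {v : V} (h : G.IsPathList l v v) : l = [v] := by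
  obtain ⟨h1, h2, h3, h4⟩ := h
  match l with
  | [] => simp at h3
  | [a] => simpa using h3
  | a :: b :: l =>
    simp only [List.head?_cons, Option.some.injEq] at h3
    subst h3
    rw [List.getLast?_cons_cons] at h4
    have := List.mem_of_mem_getLast? h4
    exact absurd this (List.nodup_cons.1 h2).1

lemma HasPathOn.left_mem {S : Set V} {v w : V} (h : G.HasPathOn S v w) : v ∈ S := by
  obtain ⟨l, hl, hS⟩ := h
  exact (hS v).1 hl.left_mem

lemma HasPathOn.right_mem {S : Set V} {v w : V} (h : G.HasPathOn S v w) : w ∈ S := by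
  obtain ⟨l, hl, hS⟩ := h
  exact (hS w).1 hl.right_mem

lemma hasPathOn_singleton (v : V) : G.HasPathOn {v} v v :=
  ⟨[v], isPathList_singleton v, by simp⟩

lemma HasPathOn.symm {S : Set V} {v w : V} (h : G.HasPathOn S v w) : G.HasPathOn S w v := by
  obtain ⟨l, hl, hS⟩ := h
  exact ⟨l.reverse, hl.reverse, by simpa using hS⟩

lemma HasPathOn.append {S T : Set V} {v w u z : V} (h : G.HasPathOn S v w)
    (h' : G.HasPathOn T u z) (hwu : G.Adj w u) (hd : Disjoint S T) :
    G.HasPathOn (S ∪ T) v z := by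
  obtain ⟨l, hl, hS⟩ := h
  obtain ⟨m, hm, hT⟩ := h'
  refine ⟨l ++ m, hl.append hm hwu ?_, by simp [hS, hT]⟩
  intro a ha hb
  exact Set.disjoint_left.1 hd ((hS a).1 ha) ((hT a).1 hb)

lemma HasPathOn.mono {S : Set V} {v w : V} (h : G.HasPathOn S v w) (hG : G ≤ G') :
    G'.HasPathOn S v w := by
  obtain ⟨l, ⟨h1, h2⟩, hS⟩ := h
  exact ⟨l, ⟨h1.imp fun _ _ h => hG h, h2⟩, hS⟩

lemma HasPathOn.map {S : Set V} {v w : V} (h : G.HasPathOn S v w) {f : V → W}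
    (hf : ∀ a ∈ S, ∀ b ∈ S, G.Adj a b → H.Adj (f a) (f b)) (hinj : Function.Injective f) :
    H.HasPathOn (f '' S) (f v) (f w) := by
  obtain ⟨l, hl, hS⟩ := h
  refine ⟨l.map f, hl.map (fun a ha b hb => hf a ((hS a).1 ha) b ((hS b).1 hb)) hinj, ?_⟩
  simp [hS]

lemma HasPathOn.induce {S T : Set V} {v w : V} (h : G.HasPathOn S v w) (hST : S ⊆ T) :
    (G.induce T).HasPathOn (Subtype.val ⁻¹' S) ⟨v, hST h.left_mem⟩ ⟨w, hST h.right_mem⟩ := by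
  obtain ⟨l, hl, hS⟩ := h
  have hlT : ∀ u ∈ l, u ∈ T := fun u hu => hST ((hS u).1 hu)
  lift l to List T using hlT
  obtain ⟨v', w', hv, hw, hl'⟩ := IsPathList.of_map (G := G.induce T) hl (fun a b h => h)
  refine ⟨l, ?_, fun u => ?_⟩
  · convert hl'
  · rw [Set.mem_preimage, ← hS]
    simp

lemma HasPathOn.ncard_eq {S : Set V} {l : List V} (hl : l.Nodup) (hS : ∀ u, u ∈ l ↔ u ∈ S) :
    S.ncard = l.length := by
  classical
  have : S = (l.toFinset : Set V) := by ext u; simp [hS]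
  rw [this, Set.ncard_coe_finset, List.toFinset_card_of_nodup hl]

lemma HasPathOn.finite {S : Set V} {v w : V} (h : G.HasPathOn S v w) : S.Finite := by
  classical
  obtain ⟨l, hl, hS⟩ := h
  have : S = (l.toFinset : Set V) := by ext u; simp [hS]
  rw [this]; exact Finset.finite_toSet _

lemma HasPathOn.two_le_ncard {S : Set V} {v w : V} (h : G.HasPathOn S v w) (hvw : v ≠ w) :
    2 ≤ S.ncard := by
  rw [← Set.ncard_pair hvw]
  exact Set.ncard_le_ncard (by rintro _ (rfl | rfl); exacts [h.left_mem, h.right_mem]) h.finite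

/-- Non-adjacent ends force an inner vertex. This is what lets a deleted edge close a path to a
genuine cycle. -/
lemma HasPathOn.three_le_ncard {S : Set V} {v w : V} (h : G.HasPathOn S v w) (hvw : v ≠ w)
    (hadj : ¬ G.Adj v w) : 3 ≤ S.ncard := by
  obtain ⟨l, hl, hS⟩ := h
  rw [HasPathOn.ncard_eq hl.2.1 hS]
  obtain ⟨h1, h2, h3, h4⟩ := hl
  match l with
  | [] => simp at h3
  | [a] => simp_all
  | [a, b] => simp_all
  | a :: b :: c :: l => simp

lemma HasPathOn.tail {S : Set V} {v w : V} (h : G.HasPathOn S v w) (hvw : v ≠ w) :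
    ∃ r, G.Adj v r ∧ G.HasPathOn (S \ {v}) r w := by
  obtain ⟨l, hl, hS⟩ := h
  match l with
  | [] => simp [IsPathList] at hl
  | [a] => exact absurd (by simpa [IsPathList] using hl : a = v ∧ a = w) (by grind)
  | a :: b :: l =>
    obtain ⟨w', u, ha, hb, hadj, hd⟩ := IsPathList.of_append (l := [a]) (m := b :: l) hl
      (by simp) (by simp)
    have h1 : a = v ∧ a = w' := by simpa [IsPathList] using ha
    obtain ⟨rfl, rfl⟩ := h1
    refine ⟨u, hadj, _, hb, fun z => ?_⟩
    have := hS z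
    have hav : a ∉ b :: l := by simpa using hd
    grind

lemma HasPathOn.split {S : Set V} {v w y : V} (h : G.HasPathOn S v w) (hy : y ∈ S) (hyv : y ≠ v)
    (hyw : y ≠ w) : ∃ S₁ S₂ r r', G.HasPathOn S₁ v r ∧ G.HasPathOn S₂ r' w ∧ G.Adj r y ∧
      G.Adj y r' ∧ Disjoint S₁ S₂ ∧ S₁ ∪ S₂ = S \ {y} := by
  obtain ⟨l, hl, hS⟩ := h
  obtain ⟨m, n, rfl⟩ := List.append_of_mem ((hS y).2 hy)
  have hm : m ≠ [] := by
    rintro rfl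
    exact hyv (by simpa using hl.2.2.1)
  have hn : n ≠ [] := by
    rintro rfl
    exact hyw (by simpa using hl.2.2.2)
  obtain ⟨r, y', h1, h2, h3, h4⟩ := hl.of_append hm (by simp)
  obtain rfl : y = y' := by simpa using h2.2.2.1
  obtain ⟨y', r', k1, k2, k3, k4⟩ := IsPathList.of_append (l := [y]) (m := n) h2 (by simp) hn
  obtain rfl : y = y' := by simpa using k1.2.2.2
  refine ⟨{u | u ∈ m}, {u | u ∈ n}, r, r', ⟨m, h1, by simp⟩, ⟨n, k2, by simp⟩, h3, k3, ?_, ?_⟩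
  · rw [Set.disjoint_left]
    intro u hu hu'
    exact h4 hu (by simp_all)
  · ext u
    have := hS u
    have hym : y ∉ m := fun h => h4 h (by simp)
    have hyn : y ∉ n := by simpa using k4
    simp only [Set.mem_union, Set.mem_ofPred_eq, Set.mem_sdiff, Set.mem_singleton_iff]
    grind

lemma HasPathOn.reachable {S : Set V} {v w u : V} (h : G.HasPathOn S v w) (hu : u ∈ S) :
    G.Reachable v u := by
  obtain ⟨l, ⟨h1, h2, h3, h4⟩, hS⟩ := h
  rw [← hS] at hu
  clear h2 h4 hS
  induction l generalizing v with
  | nil => simp at hu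
  | cons a l ih =>
    obtain rfl : a = v := by simpa using h3
    rcases List.mem_cons.1 hu with rfl | hu'
    · rfl
    · match l with
      | [] => simp at hu'
      | b :: l =>
        rw [List.isChain_cons_cons] at h1
        exact h1.1.reachable.trans (ih hu' h1.2 (by simp))

lemma HasPathOn.connected {v w : V} (h : G.HasPathOn Set.univ v w) : G.Connected :=
  haveI : Nonempty V := ⟨v⟩
  ⟨fun a b => (h.reachable (Set.mem_univ a)).symm.trans (h.reachable (Set.mem_univ b))⟩

lemma IsPathList.rotate {l m : List V} {v w : V} (h : G.IsPathList (l ++ m) v w)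
    (hwv : G.Adj w v) (hm : m ≠ []) : ∃ v' w', G.IsPathList (m ++ l) v' w' ∧ G.Adj w' v' := by
  by_cases hl : l = []
  · subst hl
    exact ⟨v, w, by simpa using h, hwv⟩
  · obtain ⟨w', u, h1, h2, h3, h4⟩ := h.of_append hl hm
    exact ⟨u, w', h2.append h1 hwv h4.symm, h3⟩

/-- Rotate the cycle so that `x` comes first and cut it off. The ends of the rest differ because at
least two vertices remain. -/
lemma HasCycleOn.exists_path_of_mem {S : Set V} {x : V} (h : G.HasCycleOn S) (hx : x ∈ S) :
    ∃ s t, s ≠ t ∧ G.Adj x s ∧ G.Adj x t ∧ G.HasPathOn (S \ {x}) s t := by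
  obtain ⟨v, w, ⟨l, hl, hS⟩, hwv, h3⟩ := h
  rw [HasPathOn.ncard_eq hl.2.1 hS] at h3
  obtain ⟨m, n, rfl⟩ := List.append_of_mem ((hS x).2 hx)
  obtain ⟨v', w', hl', hadj⟩ := hl.rotate hwv (by simp)
  rw [List.cons_append] at hl'
  have hne : n ++ m ≠ [] := by
    rintro h0
    simp at h0
    simp [h0] at h3
  obtain ⟨x', s, h1, h2, h4, h5⟩ := IsPathList.of_append (l := [x]) (m := n ++ m) hl' (by simp) hne
  obtain ⟨rfl, rfl⟩ : x = v' ∧ x = x' := by simpa [IsPathList] using h1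
  refine ⟨s, w', ?_, h4, hadj.symm, _, h2, fun u => ?_⟩
  · rintro rfl
    have := congrArg List.length h2.eq_singleton
    simp at this h3
    omega
  · have := hS u
    have : x ∉ n ++ m := by simpa using h5
    simp only [Set.mem_sdiff, Set.mem_singleton_iff]
    grind

lemma Walk.IsPath.isPathList {v w : V} {p : G.Walk v w} (hp : p.IsPath) :
    G.IsPathList p.support v w :=
  ⟨p.isChain_adj_support, hp.support_nodup, by simp [List.head?_eq_some_head p.support_ne_nil],
    by simp [List.getLast?_eq_some_getLast p.support_ne_nil]⟩

lemma Walk.IsPath.hasPathOn {v w : V} {p : G.Walk v w} (hp : p.IsPath) :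
    G.HasPathOn {u | u ∈ p.support} v w :=
  ⟨_, hp.isPathList, by simp⟩

lemma IsPathList.exists_walk {l : List V} {v w : V} (h : G.IsPathList l v w) :
    ∃ p : G.Walk v w, p.support = l := by
  obtain ⟨h1, h2, h3, h4⟩ := h
  have hne : l ≠ [] := by rintro rfl; simp at h3
  rw [List.head?_eq_some_head hne, Option.some.injEq] at h3
  rw [List.getLast?_eq_some_getLast hne, Option.some.injEq] at h4
  exact ⟨(Walk.ofSupport l hne h1).copy h3 h4, by simp⟩

lemma Walk.IsCycle.hasCycleOn {v : V} {p : G.Walk v v} (hp : p.IsCycle) :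
    G.HasCycleOn {u | u ∈ p.support} ∧ {u | u ∈ p.support}.ncard = p.length := by
  have h1 : {u | u ∈ p.support} = {u | u ∈ p.tail.support} := by
    ext u
    rw [Set.mem_ofPred_eq, Set.mem_ofPred_eq, ← Walk.cons_support_tail hp.not_nil]
    have := p.tail.end_mem_support
    grind
  have h2 : {u | u ∈ p.support}.ncard = p.length := by
    rw [h1, HasPathOn.ncard_eq (l := p.tail.support) hp.isPath_tail.support_nodup (by simp),
      Walk.length_support, Walk.length_tail_add_one hp.not_nil]
  refine ⟨⟨_, _, h1 ▸ hp.isPath_tail.hasPathOn, p.adj_snd hp.not_nil, ?_⟩, h2⟩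
  rw [h2]
  exact hp.three_le_length

lemma HasCycleOn.exists_isCycle {S : Set V} (h : G.HasCycleOn S) :
    ∃ (v : V) (p : G.Walk v v), p.IsCycle ∧ p.length = S.ncard := by
  obtain ⟨v, w, ⟨l, hl, hS⟩, hwv, h3⟩ := h
  have hc := HasPathOn.ncard_eq hl.2.1 hS
  obtain ⟨p, rfl⟩ := hl.exists_walk
  have hp : p.IsPath := Walk.IsPath.mk' hl.2.1
  refine ⟨w, Walk.cons hwv p, ?_, by simp [hc]⟩
  rw [Walk.cons_isCycle_iff]
  -- If the closing edge lay on the path, then `v` would be the second vertex of the reversed path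
  -- as well as its last, so the path would have length one.
  refine ⟨hp, fun he => ?_⟩
  rw [hc, Walk.length_support] at h3
  have h4 : p.length ≠ 1 := by omega
  have hp' := hp.reverse
  have he' : s(w, v) ∈ p.reverse.edges := by simpa using he
  have := hp'.eq_snd_of_mem_edges (w := v) (by simpa using he')
  have h5 := hp'.getVert_injOn (x₁ := 1) (x₂ := p.reverse.length)
    (by rw [Set.mem_ofPred_eq, Walk.length_reverse]; omega) (by simp) (by rw [Walk.getVert_length]; exact this.symm)
  simp at h5
  omega

lemma HasCycleOn.hamiltonian [Fintype V] [DecidableEq V] (h : G.HasCycleOn Set.univ) :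
    G.IsHamiltonian := by
  intro _
  obtain ⟨v, p, hp, hl⟩ := h.exists_isCycle
  refine ⟨v, p, Walk.isHamiltonianCycle_iff_isCycle_and_length_eq.2 ⟨hp, ?_⟩⟩
  rw [hl, Set.ncard_univ, Nat.card_eq_fintype_card]

lemma IsHamiltonian.hasCycleOn [Fintype V] [DecidableEq V] (h : G.IsHamiltonian)
    (hV : Fintype.card V ≠ 1) : G.HasCycleOn Set.univ := by
  obtain ⟨v, p, hp⟩ := h hV
  have := hp.isCycle.hasCycleOn.1
  rwa [show {u | u ∈ p.support} = Set.univ by ext u; simp [hp.mem_support]] at this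

lemma HasCycleOn.map_val {T : Set V} {S : Set T} (h : (G.induce T).HasCycleOn S) :
    G.HasCycleOn (Subtype.val '' S) := by
  obtain ⟨v, w, hp, hadj, h3⟩ := h
  exact ⟨v, w, hp.map (fun _ _ _ _ h => h) Subtype.val_injective, hadj,
    by rwa [Set.ncard_image_of_injective _ Subtype.val_injective]⟩

lemma HasCycleOn.induce {S : Set V} (h : G.HasCycleOn S) : (G.induce S).HasCycleOn Set.univ := by
  obtain ⟨v, w, hp, hadj, h3⟩ := h
  have := hp.induce subset_rfl
  rw [show (Subtype.val ⁻¹' S : Set S) = Set.univ by ext u; simp] at this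
  exact ⟨_, _, this, hadj, by rwa [Set.ncard_univ, Nat.card_coe_set_eq]⟩

lemma hasCycleOn_of_induce {S : Set V} [Fintype S] [DecidableEq S]
    (h : (G.induce S).IsHamiltonian) (hS : Fintype.card S ≠ 1) : G.HasCycleOn S := by
  have := (h.hasCycleOn hS).map_val
  rwa [Set.image_univ, Subtype.range_coe] at this

lemma IsGoodPair.hasPathOn {v w : V} (h : G.IsGoodPair v w) : G.HasPathOn Set.univ v w := by
  classical
  obtain ⟨p, hp⟩ := h
  have := hp.isPath.hasPathOn
  rwa [show {u | u ∈ p.support} = Set.univ by ext u; simp [hp.mem_support]] at this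

lemma IsGoodPairOfPairs.exists_hasPathOn {v w x y : V} (h : G.IsGoodPairOfPairs v w x y) :
    ∃ S T, G.HasPathOn S v w ∧ G.HasPathOn T x y ∧ Disjoint S T ∧ S ∪ T = Set.univ := by
  obtain ⟨p, q, hp, hq, hd, hu⟩ := h
  exact ⟨_, _, hp.hasPathOn, hq.hasPathOn, Set.disjoint_left.2 fun u h h' => hd h h',
    Set.eq_univ_of_forall hu⟩

lemma IsGoodPairAfterDelete.hasPathOn {z v w : V} (h : G.IsGoodPairAfterDelete z v w) :
    G.HasPathOn {u | u ≠ z} v w := by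
  obtain ⟨hv, hw, h⟩ := h
  have := h.hasPathOn.map (H := G) (f := Subtype.val) (fun _ _ _ _ h => h) Subtype.val_injective
  rwa [Set.image_univ, Subtype.range_coe] at this

end PathsOn

/-! ### Cycles in a graph on a disjoint union, cut into blocks -/

section Blocks

variable {V W : Type*}

lemma exists_map_inl_append (m : List (V ⊕ W)) :
    ∃ (A : List V) (m' : List (V ⊕ W)), m = A.map Sum.inl ++ m' ∧
      ∀ u, m'.head? ≠ some (Sum.inl u) := by
  induction m with
  | nil => exact ⟨[], [], by simp⟩
  | cons z m ih =>
    obtain ⟨A, m', rfl, h⟩ := ih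
    rcases z with u | w
    · exact ⟨u :: A, m', by simp, h⟩
    · exact ⟨[], _, rfl, by simp⟩

lemma exists_map_inr_append (m : List (V ⊕ W)) :
    ∃ (B : List W) (m' : List (V ⊕ W)), m = B.map Sum.inr ++ m' ∧
      ∀ w, m'.head? ≠ some (Sum.inr w) := by
  induction m with
  | nil => exact ⟨[], [], by simp⟩
  | cons z m ih =>
    obtain ⟨B, m', rfl, h⟩ := ih
    rcases z with u | w
    · exact ⟨[], _, rfl, by simp⟩
    · exact ⟨w :: B, m', by simp, h⟩

variable {K : SimpleGraph (V ⊕ W)}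

/-- A path from the left to the right summand starts with a path in the left summand, followed
by a path in the right summand. -/
lemma IsPathList.exists_blocks {m : List (V ⊕ W)} {p : V} {z : W}
    (h : K.IsPathList m (Sum.inl p) (Sum.inr z)) :
    ∃ (A : List V) (B : List W) (m' : List (V ⊕ W)) (q : V) (s t : W),
      m = A.map Sum.inl ++ (B.map Sum.inr ++ m') ∧
      (K.comap Sum.inl).IsPathList A p q ∧ (K.comap Sum.inr).IsPathList B s t ∧
      K.Adj (Sum.inl q) (Sum.inr s) ∧
      ((m' = [] ∧ t = z) ∨
        ∃ r, K.IsPathList m' (Sum.inl r) (Sum.inr z) ∧ K.Adj (Sum.inr t) (Sum.inl r)) := by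
  obtain ⟨A, m₁, rfl, h₁⟩ := exists_map_inl_append m
  have hA : A.map Sum.inl ≠ ([] : List (V ⊕ W)) := by
    intro h0
    simp only [h0, List.nil_append] at h
    exact h₁ _ h.2.2.1
  have hm₁ : m₁ ≠ [] := by
    rintro rfl
    have := h.right_mem
    simp at this
  obtain ⟨q', s', hA', hm', hqs, hd⟩ := h.of_append hA hm₁
  obtain ⟨p', q, hp, rfl, hA''⟩ := IsPathList.of_map (G := K.comap Sum.inl) hA' (fun _ _ h => h)
  obtain rfl := Sum.inl_injective hp
  obtain ⟨B, m₂, rfl, h₂⟩ := exists_map_inr_append m₁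
  rcases s' with u | s
  · exact absurd hm'.2.2.1 (h₁ u)
  have hB : B.map Sum.inr ≠ ([] : List (V ⊕ W)) := by
    intro h0
    simp only [h0, List.nil_append] at hm'
    exact h₂ _ hm'.2.2.1
  by_cases hm₂ : m₂ = []
  · subst hm₂
    rw [List.append_nil] at hm'
    obtain ⟨s', t, hs, ht, hB'⟩ := IsPathList.of_map (G := K.comap Sum.inr) hm' (fun _ _ h => h)
    obtain rfl := Sum.inr_injective hs
    obtain rfl := Sum.inr_injective ht
    exact ⟨A, B, [], q, s, z, rfl, hA'', hB', hqs, Or.inl ⟨rfl, rfl⟩⟩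
  · obtain ⟨t', r', hB', hm₂', htr, hd'⟩ := hm'.of_append hB hm₂
    obtain ⟨s', t, hs, rfl, hB''⟩ := IsPathList.of_map (G := K.comap Sum.inr) hB' (fun _ _ h => h)
    obtain rfl := Sum.inr_injective hs
    rcases r' with r | w
    · exact ⟨A, B, m₂, q, s, t, rfl, hA'', hB'', hqs, Or.inr ⟨r, hm₂', htr⟩⟩
    · exact absurd hm₂'.2.2.1 (h₂ w)

/-- Rotate to start at a right vertex, then rotate once more past the maximal initial block of right
vertices: by maximality the list now starts on the left, and it ends on the right. -/
lemma IsPathList.exists_rotate_inl_inr {m : List (V ⊕ W)} {v z : V ⊕ W}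
    (h : K.IsPathList m v z) (hzv : K.Adj z v) {u : V} {w : W} (hu : Sum.inl u ∈ m)
    (hw : Sum.inr w ∈ m) : ∃ (n : List (V ⊕ W)) (p : V) (t : W),
      K.IsPathList n (Sum.inl p) (Sum.inr t) ∧ K.Adj (Sum.inr t) (Sum.inl p) ∧
      ∀ x, x ∈ n ↔ x ∈ m := by
  obtain ⟨m₁, m₂, rfl⟩ := List.append_of_mem hw
  obtain ⟨v', z', h', hzv'⟩ := h.rotate hzv (by simp)
  obtain ⟨B, m', hBm, hm'⟩ := exists_map_inr_append (Sum.inr w :: m₂ ++ m₁)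
  have hmem : ∀ x, x ∈ B.map Sum.inr ++ m' ↔ x ∈ m₁ ++ Sum.inr w :: m₂ := by
    intro x
    rw [← hBm]
    simp only [List.cons_append, List.mem_cons, List.mem_append]
    tauto
  rw [hBm] at h'
  have hne : m' ≠ [] := by
    rintro rfl
    have := (hmem _).2 hu
    simp at this
  have hB : B ≠ [] := by
    rintro rfl
    simp only [List.map_nil, List.nil_append] at hBm
    exact hm' w (by rw [← hBm]; rfl)
  obtain ⟨p', t', h'', htp⟩ := h'.rotate hzv' hne
  have hp : ∃ p, p' = Sum.inl p := by
    rcases p' with p | p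
    · exact ⟨p, rfl⟩
    · have := h''.2.2.1
      rw [List.head?_append_of_ne_nil _ hne] at this
      exact absurd this (hm' p)
  have ht : ∃ t, t' = Sum.inr t := by
    have := h''.2.2.2
    rw [List.getLast?_append_of_ne_nil _ (by simpa using hB)] at this
    simp only [List.getLast?_map, Option.map_eq_some_iff] at this
    obtain ⟨t, -, rfl⟩ := this
    exact ⟨t, rfl⟩
  obtain ⟨p, rfl⟩ := hp
  obtain ⟨t, rfl⟩ := ht
  refine ⟨_, p, t, h'', htp, fun x => ?_⟩
  rw [← hmem x]
  simp only [List.mem_append]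
  tauto

/-- The possible shapes of a cycle in a graph on a disjoint union, in which at most four vertices
of the left summand have a neighbour in the right summand, and each of them only one. -/
lemma HasCycleOn.exists_blocks {S : Set (V ⊕ W)} (h : K.HasCycleOn S) {a b c d : V}
    (hM : ∀ p s t, K.Adj (Sum.inl p) (Sum.inr s) → K.Adj (Sum.inl p) (Sum.inr t) → s = t)
    (h4 : ∀ p s, K.Adj (Sum.inl p) (Sum.inr s) → p = a ∨ p = b ∨ p = c ∨ p = d) :
    (∃ A, (K.comap Sum.inl).HasCycleOn A ∧ S = Sum.inl '' A) ∨
    (∃ B, (K.comap Sum.inr).HasCycleOn B ∧ S = Sum.inr '' B) ∨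
    (∃ A B p q s t, (K.comap Sum.inl).HasPathOn A p q ∧ (K.comap Sum.inr).HasPathOn B s t ∧
      K.Adj (Sum.inl q) (Sum.inr s) ∧ K.Adj (Sum.inl p) (Sum.inr t) ∧ p ≠ q ∧
      S = Sum.inl '' A ∪ Sum.inr '' B) ∨
    (∃ A₁ B₁ A₂ B₂ p₁ q₁ s₁ t₁ p₂ q₂ s₂ t₂,
      (K.comap Sum.inl).HasPathOn A₁ p₁ q₁ ∧ (K.comap Sum.inr).HasPathOn B₁ s₁ t₁ ∧
      (K.comap Sum.inl).HasPathOn A₂ p₂ q₂ ∧ (K.comap Sum.inr).HasPathOn B₂ s₂ t₂ ∧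
      K.Adj (Sum.inl q₁) (Sum.inr s₁) ∧ K.Adj (Sum.inl p₂) (Sum.inr t₁) ∧
      K.Adj (Sum.inl q₂) (Sum.inr s₂) ∧ K.Adj (Sum.inl p₁) (Sum.inr t₂) ∧
      p₁ ≠ q₁ ∧ p₂ ≠ q₂ ∧ Disjoint A₁ A₂ ∧ Disjoint B₁ B₂ ∧
      S = Sum.inl '' (A₁ ∪ A₂) ∪ Sum.inr '' (B₁ ∪ B₂)) := by
  obtain ⟨v, z, ⟨l, hl, hS⟩, hzv, h3⟩ := h
  have hS' : S = {x | x ∈ l} := by ext x; simp [hS]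
  by_cases hr : ∃ w, Sum.inr w ∈ l
  swap
  · left
    have : ∃ A : List V, l = A.map Sum.inl := by
      obtain ⟨A, m', rfl, hm'⟩ := exists_map_inl_append l
      rcases m' with _ | ⟨u | w, m'⟩
      · exact ⟨A, by simp⟩
      · simp at hm'
      · exact absurd ⟨w, by simp⟩ hr
    obtain ⟨A, rfl⟩ := this
    obtain ⟨v', z', rfl, rfl, hA⟩ := IsPathList.of_map (G := K.comap Sum.inl) hl (fun _ _ h => h)
    refine ⟨{u | u ∈ A}, ⟨v', z', ⟨A, hA, by simp⟩, hzv, ?_⟩, by ext x; simp [hS']⟩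
    rw [HasPathOn.ncard_eq hl.2.1 hS, List.length_map] at h3
    rwa [HasPathOn.ncard_eq (l := A) hA.2.1 (by simp)]
  right
  obtain ⟨w, hw⟩ := hr
  by_cases hr : ∃ u, Sum.inl u ∈ l
  swap
  · left
    have : ∃ A : List W, l = A.map Sum.inr := by
      obtain ⟨A, m', rfl, hm'⟩ := exists_map_inr_append l
      rcases m' with _ | ⟨u | w, m'⟩
      · exact ⟨A, by simp⟩
      · exact absurd ⟨u, by simp⟩ hr
      · simp at hm'
    obtain ⟨A, rfl⟩ := this
    obtain ⟨v', z', rfl, rfl, hA⟩ := IsPathList.of_map (G := K.comap Sum.inr) hl (fun _ _ h => h)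
    refine ⟨{u | u ∈ A}, ⟨v', z', ⟨A, hA, by simp⟩, hzv, ?_⟩, by ext x; simp [hS']⟩
    rw [HasPathOn.ncard_eq hl.2.1 hS, List.length_map] at h3
    rwa [HasPathOn.ncard_eq (l := A) hA.2.1 (by simp)]
  right
  obtain ⟨u, hu⟩ := hr
  obtain ⟨n, p, t, hn, htp, hnl⟩ := hl.exists_rotate_inl_inr hzv hu hw
  have hSn : ∀ x, x ∈ n ↔ x ∈ S := fun x => (hnl x).trans (hS x)
  clear hS hS' hl hzv hw hu hnl l
  rw [HasPathOn.ncard_eq hn.2.1 hSn] at h3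
  obtain ⟨A₁, B₁, m₁, q₁, s₁, t₁, rfl, hA₁, hB₁, hqs, ⟨rfl, rfl⟩ | ⟨p₂, hm₁, htr⟩⟩ :=
    hn.exists_blocks
  · left
    refine ⟨{x | x ∈ A₁}, {x | x ∈ B₁}, p, q₁, s₁, t₁, ⟨_, hA₁, by simp⟩, ⟨_, hB₁, by simp⟩, hqs,
      htp.symm, ?_, ?_⟩
    -- If the left block were a single vertex, its only right neighbour would be the whole right
    -- block, leaving two vertices on the cycle.
    · rintro rfl
      obtain rfl := hM _ _ _ hqs htp.symm
      rw [hA₁.eq_singleton, hB₁.eq_singleton] at h3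
      simp at h3
    · ext x
      rw [← hSn]
      simp
  right
  have hd₁ := hn.2.1
  obtain ⟨A₂, B₂, m₂, q₂, s₂, t₂, rfl, hA₂, hB₂, hqs₂, h⟩ := hm₁.exists_blocks
  obtain ⟨-, e₁, dA₁⟩ := List.nodup_append'.1 hd₁
  obtain ⟨-, e₂, dB₁⟩ := List.nodup_append'.1 e₁
  obtain ⟨-, e₃, dA₂⟩ := List.nodup_append'.1 e₂
  obtain ⟨-, -, dB₂⟩ := List.nodup_append'.1 e₃
  have memA₁ : ∀ {x}, x ∈ A₁ → Sum.inl x ∈ A₁.map (Sum.inl : V → V ⊕ W) := List.mem_map_of_mem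
  have memB₁ : ∀ {x}, x ∈ B₁ → Sum.inr x ∈ B₁.map (Sum.inr : W → V ⊕ W) := List.mem_map_of_mem
  have memA₂ : ∀ {x}, x ∈ A₂ → Sum.inl x ∈ A₂.map (Sum.inl : V → V ⊕ W) := List.mem_map_of_mem
  have memB₂ : ∀ {x}, x ∈ B₂ → Sum.inr x ∈ B₂.map (Sum.inr : W → V ⊕ W) := List.mem_map_of_mem
  have hpq₂ : p₂ ≠ q₂ := by
    rintro rfl
    obtain rfl := hM _ _ _ hqs₂ htr.symm
    exact dB₁ (memB₁ hB₁.right_mem)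
      (List.mem_append_right _ (List.mem_append_left _ (memB₂ hB₂.left_mem)))
  have hpq₁ : p ≠ q₁ := by
    rintro rfl
    obtain rfl := hM _ _ _ hqs htp.symm
    exact dB₁ (memB₁ hB₁.left_mem) hm₁.right_mem
  have hdA : Disjoint {x | x ∈ A₁} {x | x ∈ A₂} := Set.disjoint_left.2 fun x h h' =>
    dA₁ (memA₁ h) (List.mem_append_right _ (List.mem_append_left _ (memA₂ h')))
  have hdB : Disjoint {x | x ∈ B₁} {x | x ∈ B₂} := Set.disjoint_left.2 fun x h h' =>
    dB₁ (memB₁ h) (List.mem_append_right _ (List.mem_append_left _ (memB₂ h')))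
  rcases h with ⟨rfl, rfl⟩ | ⟨r, hr, htr₂⟩
  · refine ⟨{x | x ∈ A₁}, {x | x ∈ B₁}, {x | x ∈ A₂}, {x | x ∈ B₂}, p, q₁, s₁, t₁, p₂, q₂, s₂, t₂,
      ⟨_, hA₁, by simp⟩, ⟨_, hB₁, by simp⟩, ⟨_, hA₂, by simp⟩, ⟨_, hB₂, by simp⟩, hqs, htr.symm,
      hqs₂, htp.symm, hpq₁, hpq₂, hdA, hdB, ?_⟩
    ext x
    rw [← hSn]
    rcases x with x | x <;> simp
  -- A third left block would start at a fifth vertex `r` with a right neighbour, besides the four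
  -- distinct ends of the first two blocks.
  · exfalso
    have n₁ : ∀ x ∈ A₁, x ≠ r := by
      rintro x hx rfl
      exact dA₁ (memA₁ hx) (List.mem_append_right _ (List.mem_append_right _
        (List.mem_append_right _ hr.left_mem)))
    have n₂ : ∀ x ∈ A₂, x ≠ r := by
      rintro x hx rfl
      exact dA₂ (memA₂ hx) (List.mem_append_right _ hr.left_mem)
    have n₃ : ∀ x ∈ A₁, ∀ y ∈ A₂, x ≠ y := by
      rintro x hx y hy rfl
      exact Set.disjoint_left.1 hdA hx hy
    have k₁ := n₁ _ hA₁.left_mem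
    have k₂ := n₁ _ hA₁.right_mem
    have k₃ := n₂ _ hA₂.left_mem
    have k₄ := n₂ _ hA₂.right_mem
    have k₅ := n₃ _ hA₁.left_mem _ hA₂.left_mem
    have k₆ := n₃ _ hA₁.left_mem _ hA₂.right_mem
    have k₇ := n₃ _ hA₁.right_mem _ hA₂.left_mem
    have k₈ := n₃ _ hA₁.right_mem _ hA₂.right_mem
    have := h4 _ _ htp.symm
    have := h4 _ _ hqs
    have := h4 _ _ htr.symm
    have := h4 _ _ hqs₂
    have := h4 _ _ htr₂.symm
    grind

end Blocks

/-! ### From cycles of the dot product to cycles of the factors -/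

section DotProductCycles

variable {V W : Type*} {G : SimpleGraph V} {H : SimpleGraph W} {a b c d : V}
  {x y a' b' c' d' : W}

lemma dotProduct_adj_inl_inl {u v : V} :
    (G.dotProduct H a b c d x y a' b' c' d').Adj (Sum.inl u) (Sum.inl v) ↔
      (G.deleteEdges {s(a, b), s(c, d)}).Adj u v := by
  simp [dotProduct]

lemma dotProduct_adj_inr_inr {u v : {w : W | w ≠ x ∧ w ≠ y}} :
    (G.dotProduct H a b c d x y a' b' c' d').Adj (Sum.inr u) (Sum.inr v) ↔
      H.Adj u.1 v.1 := by
  simp [dotProduct]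

lemma dotProduct_adj_inl_inr {u : V} {w : {w : W | w ≠ x ∧ w ≠ y}} :
    (G.dotProduct H a b c d x y a' b' c' d').Adj (Sum.inl u) (Sum.inr w) ↔
      ((u = a ∧ w.1 = a') ∨ (u = b ∧ w.1 = b') ∨ (u = c ∧ w.1 = c') ∨ (u = d ∧ w.1 = d')) := by
  simp only [dotProduct, sup_adj, sum_adj, fromRel_adj]
  constructor
  · rintro (h | ⟨-, ⟨u', w', h1, h2, h3⟩ | ⟨u', w', h1, h2, h3⟩⟩)
    · simp at h
    · obtain rfl := Sum.inl_injective h1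
      obtain rfl := Sum.inr_injective h2
      exact h3
    · simp at h1
  · intro h
    exact Or.inr ⟨by simp, Or.inl ⟨u, w, rfl, rfl, h⟩⟩

lemma dotProduct_adj_inr_inl {u : V} {w : {w : W | w ≠ x ∧ w ≠ y}} :
    (G.dotProduct H a b c d x y a' b' c' d').Adj (Sum.inr w) (Sum.inl u) ↔
      ((u = a ∧ w.1 = a') ∨ (u = b ∧ w.1 = b') ∨ (u = c ∧ w.1 = c') ∨ (u = d ∧ w.1 = d')) := by
  rw [adj_comm, dotProduct_adj_inl_inr]

lemma AreOtherNeighbors.adj_left (h : H.AreOtherNeighbors x y a' b' c' d') {w : W} :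
    H.Adj x w ↔ w = a' ∨ w = b' ∨ w = y := by
  rw [← mem_neighborSet, h.1]; rfl

lemma AreOtherNeighbors.adj_right (h : H.AreOtherNeighbors x y a' b' c' d') {w : W} :
    H.Adj y w ↔ w = c' ∨ w = d' ∨ w = x := by
  rw [← mem_neighborSet, h.2]; rfl

lemma AreOtherNeighbors.symm (h : H.AreOtherNeighbors x y a' b' c' d') :
    H.AreOtherNeighbors y x c' d' a' b' := ⟨h.2, h.1⟩

lemma HasPathOn.hasCycleOn {S : Set V} {v w u₁ u₂ u₃ : V} (h : G.HasPathOn S v w)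
    (hwv : G.Adj w v) (h₁ : u₁ ∈ S) (h₂ : u₂ ∈ S) (h₃ : u₃ ∈ S) (h₁₂ : u₁ ≠ u₂) (h₁₃ : u₁ ≠ u₃)
    (h₂₃ : u₂ ≠ u₃) : G.HasCycleOn S := by
  refine ⟨v, w, h, hwv, ?_⟩
  have := h.finite
  exact (Set.two_lt_ncard_iff this).2 ⟨u₁, u₂, u₃, h₁, h₂, h₃, h₁₂, h₁₃, h₂₃⟩

/-- Two vertices of the other graph close a path to a cycle. -/
lemma HasPathOn.hasCycleOn_insert_insert {S : Set V} {s t u v : V} (h : G.HasPathOn S s t)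
    (htu : G.Adj t u) (huv : G.Adj u v) (hvs : G.Adj v s) (hu : u ∉ S) (hv : v ∉ S) :
    G.HasCycleOn (insert u (insert v S)) := by
  have h1 := (h.append (hasPathOn_singleton u) htu (by simpa)).append (hasPathOn_singleton v) huv
    (by simpa using ⟨huv.ne', hv⟩)
  have h2 : S ∪ {u} ∪ {v} = insert u (insert v S) := by ext; simp; tauto
  rw [h2] at h1
  refine h1.hasCycleOn hvs (u₁ := u) (u₂ := v) (u₃ := s) (by simp) (by simp)
    (by simp [h.left_mem]) huv.ne ?_ hvs.ne
  rintro rfl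
  exact hu h.left_mem

/-- Two vertices and two paths alternate on a cycle. -/
lemma HasPathOn.hasCycleOn_insert_union_insert {S T : Set V} {s t s' t' u v : V}
    (h : G.HasPathOn S s t) (h' : G.HasPathOn T s' t') (htu : G.Adj t u) (hus : G.Adj u s')
    (htv : G.Adj t' v) (hvs : G.Adj v s) (hu : u ∉ S ∪ T) (hv : v ∉ S ∪ T) (huv : u ≠ v)
    (hST : Disjoint S T) : G.HasCycleOn (insert u (insert v (S ∪ T))) := by
  rw [Set.mem_union, not_or] at hu hv
  have h1 := ((h.append (hasPathOn_singleton u) htu (by simpa using hu.1)).append h' hus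
    (by simpa [hST] using hu.2)).append (hasPathOn_singleton v) htv
    (by simp only [Set.disjoint_singleton_right, Set.mem_union, Set.mem_singleton_iff]; grind)
  have h2 : S ∪ {u} ∪ T ∪ {v} = insert u (insert v (S ∪ T)) := by ext; simp; tauto
  rw [h2] at h1
  refine h1.hasCycleOn hvs (u₁ := u) (u₂ := v) (u₃ := s) (by simp) (by simp)
    (by simp [h.left_mem]) huv ?_ hvs.ne
  rintro rfl
  exact hu.1 h.left_mem

lemma ncard_image_inl_union_image_inr {W' : Type*} {A : Set V} {B : Set W'} (hA : A.Finite)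
    (hB : B.Finite) :
    (Sum.inl '' A ∪ Sum.inr '' B).ncard = A.ncard + B.ncard := by
  rw [Set.ncard_union_eq _ (hA.image _) (hB.image _),
    Set.ncard_image_of_injective _ Sum.inl_injective,
    Set.ncard_image_of_injective _ Sum.inr_injective]
  · rw [Set.disjoint_left]
    rintro _ ⟨u, -, rfl⟩ ⟨w, -, h⟩
    cases h

/-- A cycle in the dot product gives rise to a cycle of at most the same length in one of the
factors, which is hamiltonian if the given cycle is. -/
theorem HasCycleOn.of_dotProduct (hab : G.Adj a b) (hcd : G.Adj c d) (hac : a ≠ c) (had : a ≠ d)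
    (hbc : b ≠ c) (hbd : b ≠ d) (hxy : H.Adj x y) (hN : H.AreOtherNeighbors x y a' b' c' d')
    (hW : ∃ w, w ≠ x ∧ w ≠ y)
    {S : Set (V ⊕ {w : W | w ≠ x ∧ w ≠ y})}
    (h : (G.dotProduct H a b c d x y a' b' c' d').HasCycleOn S) :
    (∃ T, G.HasCycleOn T ∧ T.ncard ≤ S.ncard ∧ (S = Set.univ → T = Set.univ)) ∨
    (∃ T, H.HasCycleOn T ∧ T.ncard ≤ S.ncard ∧ (S = Set.univ → T = Set.univ)) := by
  set K := G.dotProduct H a b c d x y a' b' c' d' with hK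
  have hG : K.comap Sum.inl ≤ G := fun u v h =>
    (deleteEdges_le _) (dotProduct_adj_inl_inl.1 h)
  have hGab : ¬ (K.comap Sum.inl).Adj a b := fun h => by
    have := dotProduct_adj_inl_inl.1 h
    simp at this
  have hGcd : ¬ (K.comap Sum.inl).Adj c d := fun h => by
    have := dotProduct_adj_inl_inl.1 h
    simp at this
  have hH : ∀ {B : Set {w : W | w ≠ x ∧ w ≠ y}} {s t}, (K.comap Sum.inr).HasPathOn B s t →
      H.HasPathOn (Subtype.val '' B) s.1 t.1 := fun h =>
    h.map (fun _ _ _ _ h => dotProduct_adj_inr_inr.1 h) Subtype.val_injective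
  have hx : ∀ B : Set {w : W | w ≠ x ∧ w ≠ y}, x ∉ Subtype.val '' B := by
    rintro B ⟨w, -, h⟩
    exact w.2.1 h
  have hy : ∀ B : Set {w : W | w ≠ x ∧ w ≠ y}, y ∉ Subtype.val '' B := by
    rintro B ⟨w, -, h⟩
    exact w.2.2 h
  -- Closing through `x` and `y` costs two vertices. They are paid for by the at least two vertices
  -- on the left side that are dropped.
  have hcard : ∀ B : Set {w : W | w ≠ x ∧ w ≠ y}, B.Finite →
      (insert x (insert y (Subtype.val '' B))).ncard ≤ B.ncard + 2 := by
    intro B hB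
    have h1 := Set.ncard_insert_le x (insert y (Subtype.val '' B))
    have h2 := Set.ncard_insert_le y (Subtype.val '' B)
    rw [Set.ncard_image_of_injective _ Subtype.val_injective] at h2
    omega
  have huniv : ∀ B : Set {w : W | w ≠ x ∧ w ≠ y}, (∀ w, w ∈ B) →
      insert x (insert y (Subtype.val '' B)) = Set.univ := by
    intro B hB
    ext w
    by_cases h1 : w = x
    · simp [h1]
    by_cases h2 : w = y
    · simp [h2]
    simpa [h1, h2] using hB ⟨w, h1, h2⟩
  -- Each new edge belongs to the edge `ab` and the vertex `x`, or to `cd` and `y`; only this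
  -- distinction matters below.
  have hside : ∀ p w, K.Adj (Sum.inl p) (Sum.inr w) →
      ((p = a ∨ p = b) ∧ H.Adj x w.1) ∨ ((p = c ∨ p = d) ∧ H.Adj y w.1) := by
    intro p w h
    rw [hN.adj_left, hN.adj_right]
    rcases dotProduct_adj_inl_inr.1 h with h | h | h | h <;> grind
  have hM : ∀ p s t, K.Adj (Sum.inl p) (Sum.inr s) → K.Adj (Sum.inl p) (Sum.inr t) → s = t := by
    intro p s t h h'
    have h1 := dotProduct_adj_inl_inr.1 h
    have h2 := dotProduct_adj_inl_inr.1 h'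
    have := hab.ne
    have := hcd.ne
    apply Subtype.ext
    grind
  have h4 : ∀ p s, K.Adj (Sum.inl p) (Sum.inr s) → p = a ∨ p = b ∨ p = c ∨ p = d := by
    intro p s h
    rcases dotProduct_adj_inl_inr.1 h with h | h | h | h <;> simp [h.1]
  have hX : ∀ {p q}, (p = a ∨ p = b) → (q = a ∨ q = b) → p ≠ q →
      G.Adj p q ∧ ¬ (K.comap Sum.inl).Adj p q := by
    rintro p q (rfl | rfl) (rfl | rfl) hpq
    · exact absurd rfl hpq
    · exact ⟨hab, hGab⟩
    · exact ⟨hab.symm, fun h => hGab h.symm⟩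
    · exact absurd rfl hpq
  have hY : ∀ {p q}, (p = c ∨ p = d) → (q = c ∨ q = d) → p ≠ q →
      G.Adj p q ∧ ¬ (K.comap Sum.inl).Adj p q := by
    rintro p q (rfl | rfl) (rfl | rfl) hpq
    · exact absurd rfl hpq
    · exact ⟨hcd, hGcd⟩
    · exact ⟨hcd.symm, fun h => hGcd h.symm⟩
    · exact absurd rfl hpq
  rcases h.exists_blocks hM h4 with ⟨A, ⟨p, q, hA, hpq, h3⟩, rfl⟩ | ⟨B, ⟨s, t, hB, hst, h3⟩, rfl⟩ |
    ⟨A, B, p, q, s, t, hA, hB, hqs, hpt, hpq, rfl⟩ |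
    ⟨A₁, B₁, A₂, B₂, p₁, q₁, s₁, t₁, p₂, q₂, s₂, t₂, hA₁, hB₁, hA₂, hB₂, hqs₁, hpt₁, hqs₂, hpt₂,
      hpq₁, hpq₂, hdA, hdB, rfl⟩
  · left
    refine ⟨A, ⟨p, q, hA.mono hG, hG hpq, h3⟩, ?_, fun h => ?_⟩
    · rw [Set.ncard_image_of_injective _ Sum.inl_injective]
    · obtain ⟨w, hw⟩ := hW
      have : Sum.inr ⟨w, hw⟩ ∈ (Sum.inl '' A : Set (V ⊕ {w : W | w ≠ x ∧ w ≠ y})) := by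
        rw [h]; trivial
      simp at this
  · right
    refine ⟨Subtype.val '' B, ⟨s, t, hH hB, dotProduct_adj_inr_inr.1 hst, ?_⟩, ?_, fun h => ?_⟩
    · rwa [Set.ncard_image_of_injective _ Subtype.val_injective]
    · rw [Set.ncard_image_of_injective _ Subtype.val_injective,
        Set.ncard_image_of_injective _ Sum.inr_injective]
    · have : Sum.inl a ∈ (Sum.inr '' B : Set (V ⊕ {w : W | w ≠ x ∧ w ≠ y})) := by
        rw [h]; trivial
      simp at this
  · have hn := hA.two_le_ncard hpq
    rw [ncard_image_inl_union_image_inr hA.finite hB.finite]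
    have hAu : Sum.inl '' A ∪ Sum.inr '' B = Set.univ → A = Set.univ := by
      intro h
      ext u
      have : Sum.inl u ∈ Sum.inl '' A ∪ Sum.inr '' B := by rw [h]; trivial
      simpa using this
    have hBu : Sum.inl '' A ∪ Sum.inr '' B = Set.univ → ∀ w, w ∈ B := by
      intro h w
      have : Sum.inr w ∈ Sum.inl '' A ∪ Sum.inr '' B := by rw [h]; trivial
      simpa using this
    have hcB := hcard B hB.finite
    have hB' := hH hB
    -- Ends on the same side are the two ends of a deleted edge, which closes `A` in `G`. Ends on
    -- different sides close `B` through the edge `xy` in `H`.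
    rcases hside _ _ hqs with ⟨hq, hs⟩ | ⟨hq, hs⟩ <;> rcases hside _ _ hpt with ⟨hp, ht⟩ | ⟨hp, ht⟩
    · left
      obtain ⟨h1, h2⟩ := hX hp hq hpq
      exact ⟨A, ⟨p, q, hA.mono hG, h1.symm, hA.three_le_ncard hpq h2⟩, by omega, hAu⟩
    · right
      refine ⟨_, hB'.symm.hasCycleOn_insert_insert hs.symm hxy ht (hx B) (hy B), by omega,
        fun h => huniv B (hBu h)⟩
    · right
      refine ⟨_, hB'.hasCycleOn_insert_insert ht.symm hxy hs (hx B) (hy B), by omega,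
        fun h => huniv B (hBu h)⟩
    · left
      obtain ⟨h1, h2⟩ := hY hp hq hpq
      exact ⟨A, ⟨p, q, hA.mono hG, h1.symm, hA.three_le_ncard hpq h2⟩, by omega, hAu⟩
  · have hn₁ := hA₁.two_le_ncard hpq₁
    have hn₂ := hA₂.two_le_ncard hpq₂
    have hfA := hA₁.finite.union hA₂.finite
    have hfB := hB₁.finite.union hB₂.finite
    rw [ncard_image_inl_union_image_inr hfA hfB, Set.ncard_union_eq hdA hA₁.finite hA₂.finite]
    have hcB := hcard _ hfB
    have hAu : Sum.inl '' (A₁ ∪ A₂) ∪ Sum.inr '' (B₁ ∪ B₂) = Set.univ → A₁ ∪ A₂ = Set.univ := by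
      intro h
      ext u
      have : Sum.inl u ∈ Sum.inl '' (A₁ ∪ A₂) ∪ Sum.inr '' (B₁ ∪ B₂) := by rw [h]; trivial
      simpa using this
    have hBu : Sum.inl '' (A₁ ∪ A₂) ∪ Sum.inr '' (B₁ ∪ B₂) = Set.univ → ∀ w, w ∈ B₁ ∪ B₂ := by
      intro h w
      have : Sum.inr w ∈ Sum.inl '' (A₁ ∪ A₂) ∪ Sum.inr '' (B₁ ∪ B₂) := by rw [h]; trivial
      simpa using this
    have hn : ∀ u ∈ A₁, ∀ v ∈ A₂, u ≠ v := by
      rintro u hu v hv rfl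
      exact Set.disjoint_left.1 hdA hu hv
    have k₁ := hn _ hA₁.left_mem _ hA₂.left_mem
    have k₂ := hn _ hA₁.left_mem _ hA₂.right_mem
    have k₃ := hn _ hA₁.right_mem _ hA₂.left_mem
    have k₄ := hn _ hA₁.right_mem _ hA₂.right_mem
    have hdB' : Disjoint (Subtype.val '' B₁) (Subtype.val '' B₂) :=
      (Set.disjoint_image_iff Subtype.val_injective).2 hdB
    have hB₁' := hH hB₁
    have hB₂' := hH hB₂
    have hGcyc : ∀ {p q r s}, (K.comap Sum.inl).HasPathOn A₁ p q →
        (K.comap Sum.inl).HasPathOn A₂ r s → G.Adj q r → G.Adj s p → p ≠ q →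
        ∃ T, G.HasCycleOn T ∧ T.ncard ≤ A₁.ncard + A₂.ncard + (B₁ ∪ B₂).ncard ∧
          (Sum.inl '' (A₁ ∪ A₂) ∪ Sum.inr '' (B₁ ∪ B₂) = Set.univ → T = Set.univ) := by
      intro p q r s h h' h1 h2 h3
      refine ⟨A₁ ∪ A₂, ⟨p, s, (h.mono hG).append (h'.mono hG) h1 hdA, h2, ?_⟩, ?_, hAu⟩
      · rw [Set.ncard_union_eq hdA hA₁.finite hA₂.finite]
        omega
      · rw [Set.ncard_union_eq hdA hA₁.finite hA₂.finite]
        omega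
    have hHcyc : ∀ {s t s' t' : W}, H.HasPathOn (Subtype.val '' B₁) s t →
        H.HasPathOn (Subtype.val '' B₂) s' t' → H.Adj t x → H.Adj x s' → H.Adj t' y →
        H.Adj y s → ∃ T, H.HasCycleOn T ∧ T.ncard ≤ A₁.ncard + A₂.ncard + (B₁ ∪ B₂).ncard ∧
          (Sum.inl '' (A₁ ∪ A₂) ∪ Sum.inr '' (B₁ ∪ B₂) = Set.univ → T = Set.univ) := by
      intro s t s' t' h h' h1 h2 h3 h4
      have := h.hasCycleOn_insert_union_insert h' h1 h2 h3 h4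
        (by rw [← Set.image_union]; exact hx _) (by rw [← Set.image_union]; exact hy _) hxy.ne hdB'
      rw [← Set.image_union] at this
      exact ⟨_, this, by omega, fun h => huniv _ (hBu h)⟩
    have three : ∀ {u v p q r : V}, (p = u ∨ p = v) → (q = u ∨ q = v) → (r = u ∨ r = v) →
        p ≠ q → p ≠ r → q ≠ r → False := by
      rintro u v p q r (rfl | rfl) (rfl | rfl) (rfl | rfl) h1 h2 h3 <;> contradiction
    -- The four ends are distinct, so two of them lie on `ab` and two on `cd`; `three` rules out the
    -- ten other cases. If each left path joins the two ends of one deleted edge, then `B₁`, `x`,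
    -- `B₂`, `y` close up in `H`; otherwise `ab` and `cd` join `A₁` to `A₂` in `G`.
    rcases hside _ _ hpt₂ with ⟨e₁, f₁⟩ | ⟨e₁, f₁⟩ <;>
      rcases hside _ _ hqs₁ with ⟨e₂, f₂⟩ | ⟨e₂, f₂⟩ <;>
      rcases hside _ _ hpt₁ with ⟨e₃, f₃⟩ | ⟨e₃, f₃⟩ <;>
      rcases hside _ _ hqs₂ with ⟨e₄, f₄⟩ | ⟨e₄, f₄⟩
    · exact (three e₁ e₂ e₃ hpq₁ k₁ k₃).elim
    · exact (three e₁ e₂ e₃ hpq₁ k₁ k₃).elim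
    · exact (three e₁ e₂ e₄ hpq₁ k₂ k₄).elim
    · exact Or.inr (hHcyc hB₁'.symm hB₂'.symm f₂.symm f₁ f₄.symm f₃)
    · exact (three e₁ e₃ e₄ k₁ k₂ hpq₂).elim
    · exact Or.inl (hGcyc hA₁ hA₂.symm (hY e₂ e₄ k₄).1 (hX e₃ e₁ k₁.symm).1 hpq₁)
    · exact Or.inl (hGcyc hA₁ hA₂ (hY e₂ e₃ k₃).1 (hX e₄ e₁ k₂.symm).1 hpq₁)
    · exact (three e₂ e₃ e₄ k₃ k₄ hpq₂).elim
    · exact (three e₂ e₃ e₄ k₃ k₄ hpq₂).elim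
    · exact Or.inl (hGcyc hA₁ hA₂ (hX e₂ e₃ k₃).1 (hY e₄ e₁ k₂.symm).1 hpq₁)
    · exact Or.inl (hGcyc hA₁ hA₂.symm (hX e₂ e₄ k₄).1 (hY e₃ e₁ k₁.symm).1 hpq₁)
    · exact (three e₁ e₃ e₄ k₁ k₂ hpq₂).elim
    · exact Or.inr (hHcyc hB₁' hB₂' f₃.symm f₄ f₁.symm f₂)
    · exact (three e₁ e₂ e₄ hpq₁ k₂ k₄).elim
    · exact (three e₁ e₂ e₃ hpq₁ k₁ k₃).elim
    · exact (three e₁ e₂ e₃ hpq₁ k₁ k₃).elim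

end DotProductCycles

/-! ### Hamiltonian cycles of the vertex-deleted dot product -/

section DotProductHypohamiltonian

variable {V W : Type*} {G : SimpleGraph V} {H : SimpleGraph W} {a b c d : V}
  {x y a' b' c' d' : W}

/-- With `y` gone, the only neighbours of `x` left are `a'` and `b'`, so a cycle through `x` passes
through both; remove `x` from it. -/
lemma AreOtherNeighbors.hasPathOn (hN : H.AreOtherNeighbors x y a' b' c' d')
    (hxy : H.Adj x y) (h : H.HasCycleOn {u | u ≠ y}) :
    H.HasPathOn {u | u ≠ x ∧ u ≠ y} a' b' := by
  obtain ⟨s, t, hst, hs, ht, hp⟩ := h.exists_path_of_mem (x := x) hxy.ne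
  rw [hN.adj_left] at hs ht
  have h1 := hp.left_mem
  have h2 := hp.right_mem
  rw [show {u | u ≠ y} \ {x} = {u | u ≠ x ∧ u ≠ y} by ext; simp; tauto] at hp
  simp only [Set.mem_sdiff, Set.mem_ofPred_eq, Set.mem_singleton_iff] at h1 h2
  rcases hs with rfl | rfl | rfl <;> rcases ht with rfl | rfl | rfl <;>
    first
    | exact hp
    | exact hp.symm
    | (exfalso; tauto)

/-- Remove `x` and `y` from a hamiltonian cycle of `H - v`. If it uses the edge `xy`, one path
remains; if not, `y` is an inner vertex of the path left by removing `x`, and two paths remain, each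
joining a neighbour of `x` to one of `y`. -/
lemma AreOtherNeighbors.exists_paths (hN : H.AreOtherNeighbors x y a' b' c' d')
    (hxy : H.Adj x y) {v : W} (hvx : v ≠ x) (hvy : v ≠ y) (h : H.HasCycleOn {u | u ≠ v}) :
    (∃ s t, (s = a' ∨ s = b') ∧ (t = c' ∨ t = d') ∧
      H.HasPathOn {u | (u ≠ x ∧ u ≠ y) ∧ u ≠ v} s t) ∨
    (∃ S T, Disjoint S T ∧ S ∪ T = {u | (u ≠ x ∧ u ≠ y) ∧ u ≠ v} ∧
      ((H.HasPathOn S a' c' ∧ H.HasPathOn T d' b') ∨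
        (H.HasPathOn S a' d' ∧ H.HasPathOn T c' b'))) := by
  have key : ∀ t, t ≠ y → (t = a' ∨ t = b') → H.HasPathOn ({u | u ≠ v} \ {x}) y t →
      (∃ s t, (s = a' ∨ s = b') ∧ (t = c' ∨ t = d') ∧
        H.HasPathOn {u | (u ≠ x ∧ u ≠ y) ∧ u ≠ v} s t) := by
    intro t hty ht hp
    obtain ⟨r, hr, hp'⟩ := hp.tail hty.symm
    rw [hN.adj_right] at hr
    have h1 := hp'.left_mem
    simp only [Set.mem_sdiff, Set.mem_ofPred_eq, Set.mem_singleton_iff] at h1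
    rw [show ({u | u ≠ v} \ {x}) \ {y} = {u | (u ≠ x ∧ u ≠ y) ∧ u ≠ v} by
      ext; simp; tauto] at hp'
    exact ⟨t, r, ht, by tauto, hp'.symm⟩
  have key' : H.HasPathOn ({u | u ≠ v} \ {x}) a' b' → y ≠ a' → y ≠ b' →
      (∃ S T, Disjoint S T ∧ S ∪ T = {u | (u ≠ x ∧ u ≠ y) ∧ u ≠ v} ∧
      ((H.HasPathOn S a' c' ∧ H.HasPathOn T d' b') ∨
        (H.HasPathOn S a' d' ∧ H.HasPathOn T c' b'))) := by
    intro hp hya hyb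
    obtain ⟨S, T, r, r', h1, h2, h3, h4, h5, h6⟩ := hp.split (y := y)
      ⟨hvy.symm, hxy.ne'⟩ hya hyb
    have hr := Or.inl (b := r ∈ T) h1.right_mem
    have hr' := Or.inr (a := r' ∈ S) h2.left_mem
    rw [← Set.mem_union, h6] at hr hr'
    simp only [Set.mem_sdiff, Set.mem_ofPred_eq, Set.mem_singleton_iff] at hr hr'
    have hne : r ≠ r' := by
      rintro rfl
      exact Set.disjoint_left.1 h5 h1.right_mem h2.left_mem
    rw [adj_comm, hN.adj_right] at h3
    rw [hN.adj_right] at h4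
    refine ⟨S, T, h5, by rw [h6]; ext; simp; tauto, ?_⟩
    rcases h3 with rfl | rfl | rfl <;> rcases h4 with rfl | rfl | rfl <;>
      first
      | (exfalso; tauto)
      | exact Or.inl ⟨h1, h2⟩
      | exact Or.inr ⟨h1, h2⟩
  obtain ⟨s, t, hst, hs, ht, hp⟩ := h.exists_path_of_mem (x := x) hvx.symm
  rw [hN.adj_left] at hs ht
  by_cases hsy : s = y
  · subst hsy
    exact Or.inl (key t hst.symm (by tauto) hp)
  by_cases hty : t = y
  · subst hty
    exact Or.inl (key s hsy (by tauto) hp.symm)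
  right
  have hs' : s = a' ∨ s = b' := by tauto
  have ht' : t = a' ∨ t = b' := by tauto
  rcases hs' with rfl | rfl <;> rcases ht' with rfl | rfl
  · exact absurd rfl hst
  · exact key' hp (Ne.symm hsy) (Ne.symm hty)
  · exact key' hp.symm (Ne.symm hty) (Ne.symm hsy)
  · exact absurd rfl hst

lemma HasPathOn.dotProduct_inl {S : Set V} {p q : V}
    (h : (G.deleteEdges {s(a, b), s(c, d)}).HasPathOn S p q) :
    (G.dotProduct H a b c d x y a' b' c' d').HasPathOn (Sum.inl '' S) (Sum.inl p) (Sum.inl q) :=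
  h.map (fun _ _ _ _ h => dotProduct_adj_inl_inl.2 h) Sum.inl_injective

lemma HasPathOn.dotProduct_inr {S : Set W} {s t : W} (h : H.HasPathOn S s t)
    (hS : S ⊆ {w | w ≠ x ∧ w ≠ y}) :
    (G.dotProduct H a b c d x y a' b' c' d').HasPathOn (Sum.inr '' (Subtype.val ⁻¹' S))
      (Sum.inr ⟨s, hS h.left_mem⟩) (Sum.inr ⟨t, hS h.right_mem⟩) :=
  (h.induce hS).map (fun _ _ _ _ h => dotProduct_adj_inr_inr.2 h) Sum.inr_injective

lemma disjoint_image_inl_image_inr {W' : Type*} (A : Set V) (B : Set W') :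
    Disjoint (Sum.inl '' A) (Sum.inr '' B) := by
  rw [Set.disjoint_left]
  rintro _ ⟨u, -, rfl⟩ ⟨w, -, h⟩
  cases h

/-- A path in each factor, with ends joined by the new edges, form a cycle. -/
lemma hasCycleOn_dotProduct_of_paths {S : Set V} {T : Set W} {p q : V} {s t : W}
    (h : (G.deleteEdges {s(a, b), s(c, d)}).HasPathOn S p q) (h' : H.HasPathOn T s t)
    (hT : T ⊆ {w | w ≠ x ∧ w ≠ y}) (hpq : p ≠ q)
    (hps : (p = a ∧ s = a') ∨ (p = b ∧ s = b') ∨ (p = c ∧ s = c') ∨ (p = d ∧ s = d'))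
    (hqt : (q = a ∧ t = a') ∨ (q = b ∧ t = b') ∨ (q = c ∧ t = c') ∨ (q = d ∧ t = d')) :
    (G.dotProduct H a b c d x y a' b' c' d').HasCycleOn
      (Sum.inl '' S ∪ Sum.inr '' (Subtype.val ⁻¹' T)) := by
  have h1 := h.dotProduct_inl (H := H) (x := x) (y := y) (a' := a') (b' := b') (c' := c')
    (d' := d')
  have h2 := h'.dotProduct_inr (G := G) (a := a) (b := b) (c := c) (d := d) (a' := a')
    (b' := b') (c' := c') (d' := d') hT
  have h3 := h1.append h2.symm (dotProduct_adj_inl_inr.2 hqt) (disjoint_image_inl_image_inr _ _)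
  exact h3.hasCycleOn (dotProduct_adj_inr_inl.2 hps) (u₁ := Sum.inl p) (u₂ := Sum.inl q)
    (u₃ := Sum.inr ⟨s, hT h'.left_mem⟩) (Set.mem_union_left _ h1.left_mem) (Set.mem_union_left _ h1.right_mem)
    (Set.mem_union_right _ h2.left_mem) (by simpa) (by simp) (by simp)

/-- Two disjoint paths in each factor, with ends joined by the new edges, form a cycle. -/
lemma hasCycleOn_dotProduct_of_pairs_of_paths {S S' : Set V} {T T' : Set W} {p q p' q' : V}
    {s t s' t' : W}
    (h : (G.deleteEdges {s(a, b), s(c, d)}).HasPathOn S p q)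
    (h' : (G.deleteEdges {s(a, b), s(c, d)}).HasPathOn S' p' q')
    (hS : Disjoint S S') (k : H.HasPathOn T s t) (k' : H.HasPathOn T' s' t')
    (hT : Disjoint T T')
    (hTxy : T ∪ T' ⊆ {w | w ≠ x ∧ w ≠ y}) (hpq : p ≠ q)
    (hqs : (q = a ∧ s = a') ∨ (q = b ∧ s = b') ∨ (q = c ∧ s = c') ∨ (q = d ∧ s = d'))
    (hpt : (p' = a ∧ t = a') ∨ (p' = b ∧ t = b') ∨ (p' = c ∧ t = c') ∨ (p' = d ∧ t = d'))
    (hqs' : (q' = a ∧ s' = a') ∨ (q' = b ∧ s' = b') ∨ (q' = c ∧ s' = c') ∨ (q' = d ∧ s' = d'))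
    (hpt' : (p = a ∧ t' = a') ∨ (p = b ∧ t' = b') ∨ (p = c ∧ t' = c') ∨ (p = d ∧ t' = d')) :
    (G.dotProduct H a b c d x y a' b' c' d').HasCycleOn
      (Sum.inl '' (S ∪ S') ∪ Sum.inr '' (Subtype.val ⁻¹' (T ∪ T'))) := by
  have g := h.dotProduct_inl (H := H) (x := x) (y := y) (a' := a') (b' := b') (c' := c')
    (d' := d')
  have g' := h'.dotProduct_inl (H := H) (x := x) (y := y) (a' := a') (b' := b') (c' := c')
    (d' := d')
  have l := k.dotProduct_inr (G := G) (a := a) (b := b) (c := c) (d := d) (a' := a')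
    (b' := b') (c' := c') (d' := d') (Set.subset_union_left.trans hTxy)
  have l' := k'.dotProduct_inr (G := G) (a := a) (b := b) (c := c) (d := d) (a' := a')
    (b' := b') (c' := c') (d' := d') (Set.subset_union_right.trans hTxy)
  have hd := disjoint_image_inl_image_inr (V := V) (W' := {w : W | w ≠ x ∧ w ≠ y})
  have h1 := g.append l (dotProduct_adj_inl_inr.2 hqs) (hd _ _)
  have h2 := h1.append g' (dotProduct_adj_inr_inl.2 hpt) (Set.disjoint_union_left.2
    ⟨(Set.disjoint_image_iff Sum.inl_injective).2 hS, (hd _ _).symm⟩)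
  have h3 := h2.append l' (dotProduct_adj_inl_inr.2 hqs') (Set.disjoint_union_left.2
    ⟨Set.disjoint_union_left.2
      ⟨hd _ _, (Set.disjoint_image_iff Sum.inr_injective).2 (hT.preimage _)⟩, hd _ _⟩)
  have h4 := h3.hasCycleOn (dotProduct_adj_inr_inl.2 hpt') (u₁ := Sum.inl p) (u₂ := Sum.inl q)
    (u₃ := Sum.inr ⟨s, hTxy (Set.mem_union_left _ k.left_mem)⟩)
    (Set.mem_union_left _ (Set.mem_union_left _ (Set.mem_union_left _ g.left_mem)))
    (Set.mem_union_left _ (Set.mem_union_left _ (Set.mem_union_left _ g.right_mem)))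
    (Set.mem_union_left _ (Set.mem_union_left _ (Set.mem_union_right _ l.left_mem)))
    (by simpa) (by simp) (by simp)
  rwa [Set.union_right_comm (Sum.inl '' S), Set.union_assoc, ← Set.image_union,
    ← Set.image_union, ← Set.preimage_union] at h4

/-- The path of `G - v` from `a` to `b` is closed by the path of `H - {x, y}` from `a'` to `b'` that
comes from `H - y`; for `c` and `d` the roles of `x` and `y` are exchanged. -/
theorem hasCycleOn_dotProduct_delete_inl (hab : a ≠ b) (hcd : c ≠ d) (hxy : H.Adj x y)
    (hN : H.AreOtherNeighbors x y a' b' c' d') (hH : ∀ w, H.HasCycleOn {u | u ≠ w}) (v : V)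
    (h : (G.deleteEdges {s(a, b), s(c, d)}).HasPathOn {u | u ≠ v} a b ∨
      (G.deleteEdges {s(a, b), s(c, d)}).HasPathOn {u | u ≠ v} c d) :
    (G.dotProduct H a b c d x y a' b' c' d').HasCycleOn {z | z ≠ Sum.inl v} := by
  have hset : (Sum.inl '' {u | u ≠ v} ∪ Sum.inr '' (Subtype.val ⁻¹' {w | w ≠ x ∧ w ≠ y}) :
      Set (V ⊕ {w : W | w ≠ x ∧ w ≠ y})) = {z | z ≠ Sum.inl v} := by
    ext z
    rcases z with u | w
    · simp
    · simp only [Set.mem_union, Set.mem_image]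
      exact ⟨fun _ => by simp, fun _ => Or.inr ⟨w, w.2, rfl⟩⟩
  rcases h with h | h
  · have := hasCycleOn_dotProduct_of_paths (a := a) (b := b) (c := c) (d := d) (x := x) (y := y)
      (a' := a') (b' := b') (c' := c') (d' := d') h
      (hN.hasPathOn hxy (hH y)) subset_rfl hab (by simp) (by simp)
    rwa [hset] at this
  · have h1 := hN.symm.hasPathOn hxy.symm (hH x)
    rw [show {u | u ≠ y ∧ u ≠ x} = {u | u ≠ x ∧ u ≠ y} by ext; simp; tauto] at h1
    have := hasCycleOn_dotProduct_of_paths (a := a) (b := b) (c := c) (d := d) (x := x) (y := y)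
      (a' := a') (b' := b') (c' := c') (d' := d') h h1 subset_rfl hcd (by simp) (by simp)
    rwa [hset] at this

theorem hasCycleOn_dotProduct_delete_inr (hab : a ≠ b)
    (hac : a ≠ c) (had : a ≠ d) (hbc : b ≠ c) (hbd : b ≠ d)
    (hi_ac : (G.deleteEdges {s(a, b), s(c, d)}).HasPathOn Set.univ a c)
    (hi_ad : (G.deleteEdges {s(a, b), s(c, d)}).HasPathOn Set.univ a d)
    (hi_bc : (G.deleteEdges {s(a, b), s(c, d)}).HasPathOn Set.univ b c)
    (hi_bd : (G.deleteEdges {s(a, b), s(c, d)}).HasPathOn Set.univ b d)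
    (hi_abcd : ∃ S T, (G.deleteEdges {s(a, b), s(c, d)}).HasPathOn S a b ∧
      (G.deleteEdges {s(a, b), s(c, d)}).HasPathOn T c d ∧ Disjoint S T ∧ S ∪ T = Set.univ)
    (hxy : H.Adj x y) (hN : H.AreOtherNeighbors x y a' b' c' d')
    (hH : ∀ w, H.HasCycleOn {u | u ≠ w}) (v : {w : W | w ≠ x ∧ w ≠ y}) :
    (G.dotProduct H a b c d x y a' b' c' d').HasCycleOn {z | z ≠ Sum.inr v} := by
  have hset : (Sum.inl '' Set.univ ∪
      Sum.inr '' (Subtype.val ⁻¹' {w | (w ≠ x ∧ w ≠ y) ∧ w ≠ v.1}) :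
      Set (V ⊕ {w : W | w ≠ x ∧ w ≠ y})) = {z | z ≠ Sum.inr v} := by
    ext z
    rcases z with u | w
    · simp
    · have := w.2
      simp only [Set.mem_ofPred_eq] at this
      simp [this, Subtype.ext_iff]
  have hsub : {w | (w ≠ x ∧ w ≠ y) ∧ w ≠ v.1} ⊆ {w | w ≠ x ∧ w ≠ y} := fun w h => h.1
  rcases hN.exists_paths hxy v.2.1 v.2.2 (hH v) with ⟨s, t, hs, ht, hp⟩ | ⟨S, T, hd, hST, h⟩
  · have key : ∀ {p q}, (G.deleteEdges {s(a, b), s(c, d)}).HasPathOn Set.univ p q → p ≠ q →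
        ((p = a ∧ s = a') ∨ (p = b ∧ s = b') ∨ (p = c ∧ s = c') ∨ (p = d ∧ s = d')) →
        ((q = a ∧ t = a') ∨ (q = b ∧ t = b') ∨ (q = c ∧ t = c') ∨ (q = d ∧ t = d')) →
        (G.dotProduct H a b c d x y a' b' c' d').HasCycleOn {z | z ≠ Sum.inr v} := by
      intro p q h1 h2 h3 h4
      rw [← hset]
      exact hasCycleOn_dotProduct_of_paths h1 hp hsub h2 h3 h4
    rcases hs with hs | hs <;> rcases ht with ht | ht
    · exact key hi_ac hac (by simp [hs]) (by simp [ht])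
    · exact key hi_ad had (by simp [hs]) (by simp [ht])
    · exact key hi_bc hbc (by simp [hs]) (by simp [ht])
    · exact key hi_bd hbd (by simp [hs]) (by simp [ht])
  · obtain ⟨P, Q, hP, hQ, hPQ, hPQ'⟩ := hi_abcd
    rw [← hset, ← hST, ← hPQ']
    rw [← hST] at hsub
    rcases h with ⟨h1, h2⟩ | ⟨h1, h2⟩
    -- The cycle runs `b … a a' … c' c … d d' … b'`; in the other case it runs `b … a a' … d' d … c
    -- c' … b'`.
    · exact hasCycleOn_dotProduct_of_pairs_of_paths hP.symm hQ hPQ h1 h2 hd hsub hab.symm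
        (by simp) (by simp) (by simp) (by simp)
    · exact hasCycleOn_dotProduct_of_pairs_of_paths hP.symm hQ.symm hPQ h1 h2 hd hsub hab.symm
        (by simp) (by simp) (by simp) (by simp)

lemma IsCubicVertex.four_le_card [Finite V] {v : V} (h : G.IsCubicVertex v) :
    4 ≤ Nat.card V := by
  have h1 : (insert v (G.neighborSet v)).ncard = 4 := by
    rw [Set.ncard_insert_of_notMem (by simp) (Set.toFinite _), h]
  rw [← h1, ← Set.ncard_univ]
  exact Set.ncard_le_ncard (Set.subset_univ _) (Set.toFinite _)

lemma ncard_ne [Finite V] (v : V) : {u : V | u ≠ v}.ncard = Nat.card V - 1 := by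
  rw [← Set.ncard_univ V, ← Set.ncard_sdiff_singleton_of_mem (Set.mem_univ v)]
  congr 1
  ext; simp

/-- The bound on the order keeps the vertex-deleted graph clear of the convention that a one-vertex
graph is hamiltonian. -/
lemma IsHypohamiltonian.hasCycleOn [Fintype V] (h : G.IsHypohamiltonian) (hV : 3 ≤ Nat.card V)
    (v : V) : G.HasCycleOn {u | u ≠ v} := by
  classical
  refine hasCycleOn_of_induce (h.2 v) ?_
  rw [← Nat.card_eq_fintype_card, Nat.card_coe_set_eq, ncard_ne]
  omega

lemma isHypohamiltonian_of_hasCycleOn [Fintype V] (hV : Nat.card V ≠ 1)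
    (h : ¬ G.HasCycleOn Set.univ) (h' : ∀ v, G.HasCycleOn {u | u ≠ v}) :
    G.IsHypohamiltonian := by
  classical
  refine ⟨fun hG => h (hG.hasCycleOn ?_), fun v => (h' v).induce.hamiltonian⟩
  rwa [← Nat.card_eq_fintype_card]

lemma min_egirth_le_of_forall_hasCycleOn {U : Type*} {K : SimpleGraph U}
    (h : ∀ S, K.HasCycleOn S → (∃ T, G.HasCycleOn T ∧ T.ncard ≤ S.ncard) ∨
      (∃ T, H.HasCycleOn T ∧ T.ncard ≤ S.ncard)) : min G.egirth H.egirth ≤ K.egirth := by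
  rw [le_egirth]
  intro u p hp
  obtain ⟨h1, h2⟩ := hp.hasCycleOn
  rw [← h2]
  rcases h _ h1 with ⟨T, hT, hle⟩ | ⟨T, hT, hle⟩
  · obtain ⟨v, q, hq, hl⟩ := hT.exists_isCycle
    exact (min_le_left _ _).trans ((egirth_le_length hq).trans (by rw [hl]; exact_mod_cast hle))
  · obtain ⟨v, q, hq, hl⟩ := hT.exists_isCycle
    exact (min_le_right _ _).trans ((egirth_le_length hq).trans (by rw [hl]; exact_mod_cast hle))

end DotProductHypohamiltonian

end SimpleGraph

/-! ### Effect of a transposition on the number of cycles of a permutation -/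

section CycleCount

open Equiv Equiv.Perm

variable {α β : Type*}

/-- The number of cycles of a permutation, fixed points included. -/
noncomputable def Equiv.Perm.cycleCount (π : Perm α) : ℕ :=
  Nat.card (Quotient (SameCycle.setoid π))

/-- An equivalence relation only has to be checked along single steps of the permutation. All later
invariants of cycles are obtained this way. -/
lemma Equiv.Perm.SameCycle.rel_of_forall {π : Perm α} (s : Setoid α) (h : ∀ d, s d (π d)) {u v : α}
    (huv : π.SameCycle u v) : s u v := by
  obtain ⟨n, rfl⟩ := huv
  induction n with
  | zero => exact s.refl' _
  | succ n ih => rw [add_comm, zpow_add, zpow_one]; exact s.trans' ih (h _)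
  | pred n ih =>
    refine s.trans' ih ?_
    have := h ((π ^ (-(n : ℤ) - 1)) u)
    rw [← Perm.mul_apply, ← zpow_one_add, show (1 : ℤ) + (-n - 1) = -n by ring] at this
    exact s.symm' this

lemma Setoid.card_quotient_le_add_one [Finite α] (s t : Setoid α) (i j : α)
    (h : ∀ u v, t u v → s u v ∨ ((s u i ∨ s u j) ∧ (s v i ∨ s v j))) :
    Nat.card (Quotient s) ≤ Nat.card (Quotient t) + 1 := by
  classical
  -- Up to the merging of the classes of `i` and `j`, the relation `t` is no coarser than `s`.
  -- Setting the class of `j` aside therefore makes the remaining classes inject.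
  let f : Quotient s → Option (Quotient t) := fun q =>
    if q = ⟦j⟧ then none else some ⟦q.out⟧
  have hf : Function.Injective f := by
    intro p q hpq
    by_cases hp : p = ⟦j⟧ <;> by_cases hq : q = ⟦j⟧ <;> simp only [f, hp, hq, if_true, if_false,
      reduceCtorEq, Option.some.injEq] at hpq ⊢
    have hp' : ¬ s p.out j := fun h => hp (by rw [← p.out_eq]; exact Quotient.sound h)
    have hq' : ¬ s q.out j := fun h => hq (by rw [← q.out_eq]; exact Quotient.sound h)
    rw [← p.out_eq, ← q.out_eq]
    apply Quotient.sound
    rcases h _ _ (Quotient.exact hpq) with h | ⟨h1, h2⟩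
    · exact h
    · exact s.trans' (h1.resolve_right hp') (s.symm' (h2.resolve_right hq'))
  have := Nat.card_le_card_of_injective f hf
  rwa [Finite.card_option] at this

lemma Setoid.card_quotient_le_of_le [Finite α] {s t : Setoid α} (h : s ≤ t) :
    Nat.card (Quotient t) ≤ Nat.card (Quotient s) :=
  Nat.card_le_card_of_surjective (Quotient.map' id h) (by
    rintro ⟨u⟩
    exact ⟨⟦u⟧, rfl⟩)

/-- The equivalence relation generated by `s` and the pair `(i, j)`. -/
def Setoid.link (s : Setoid α) (i j : α) : Setoid α where
  r u v := s u v ∨ ((s u i ∨ s u j) ∧ (s v i ∨ s v j))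
  iseqv := by
    refine ⟨fun u => Or.inl (s.refl' u), fun {u v} h => ?_, fun {u v w} h h' => ?_⟩
    · rcases h with h | ⟨h1, h2⟩
      · exact Or.inl (s.symm' h)
      · exact Or.inr ⟨h2, h1⟩
    · rcases h with h | ⟨h1, h2⟩ <;> rcases h' with h' | ⟨h1', h2'⟩
      · exact Or.inl (s.trans' h h')
      · exact Or.inr ⟨h1'.imp (s.trans' h) (s.trans' h), h2'⟩
      · exact Or.inr ⟨h1, h2.imp (s.trans' (s.symm' h')) (s.trans' (s.symm' h'))⟩
      · exact Or.inr ⟨h1, h2'⟩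

lemma Setoid.link_of_rel {s : Setoid α} {i j : α} (h : s i j) {u v : α} (huv : s.link i j u v) :
    s u v := by
  rcases huv with h' | ⟨h1, h2⟩
  · exact h'
  · have h1' : s u j := h1.elim (fun h' => s.trans' h' h) id
    have h2' : s v j := h2.elim (fun h' => s.trans' h' h) id
    exact s.trans' h1' (s.symm' h2')

namespace Equiv.Perm

variable [DecidableEq α]

lemma SameCycle.link_of_mul_swap {π : Perm α} {i j u v : α}
    (h : (π * swap i j).SameCycle u v) : (SameCycle.setoid π).link i j u v := by
  refine h.rel_of_forall _ (fun d => ?_)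
  rw [mul_apply]
  by_cases hi : d = i
  · subst hi
    rw [swap_apply_left]
    exact Or.inr ⟨Or.inl (SameCycle.refl _ _), Or.inr (sameCycle_apply_left.2 (SameCycle.refl _ _))⟩
  by_cases hj : d = j
  · subst hj
    rw [swap_apply_right]
    exact Or.inr ⟨Or.inr (SameCycle.refl _ _), Or.inl (sameCycle_apply_left.2 (SameCycle.refl _ _))⟩
  rw [swap_apply_of_ne_of_ne hi hj]
  exact Or.inl (sameCycle_apply_right.2 (SameCycle.refl _ _))

variable [Finite α]

/-- The new permutation sends `i` to `π j` and then follows the old cycle of `j`, which avoids `i`,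
until it comes to `j`. -/
lemma sameCycle_mul_swap_of_not_sameCycle {π : Perm α} {i j : α} (h : ¬ π.SameCycle i j) :
    (π * swap i j).SameCycle i j := by
  have key : ∀ k : ℕ, (π * swap i j).SameCycle i ((π ^ (k + 1)) j) := by
    intro k
    have h0 : (π * swap i j).SameCycle i (π j) := by
      have : (π * swap i j) i = π j := by simp
      rw [← this]
      exact sameCycle_apply_right.2 (SameCycle.refl _ _)
    induction k with
    | zero => simpa using h0
    | succ k ih =>
      rw [pow_succ', mul_apply]
      by_cases hj : (π ^ (k + 1)) j = j
      · rw [hj]; exact h0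
      have hi : (π ^ (k + 1)) j ≠ i := by
        intro hi
        exact h (SameCycle.symm ⟨((k + 1 : ℕ) : ℤ), by rw [zpow_natCast]; exact hi⟩)
      have : (π * swap i j) ((π ^ (k + 1)) j) = π ((π ^ (k + 1)) j) := by
        rw [mul_apply, swap_apply_of_ne_of_ne hi hj]
      rw [← this]
      exact sameCycle_apply_right.2 ih
  -- The exponent becomes the order of `π`, which returns to `j` itself.
  have h1 := key (orderOf π - 1)
  rwa [Nat.sub_add_cancel (orderOf_pos π), pow_orderOf_eq_one, one_apply] at h1

/-- If `n` is least with `π ^ n` taking `i` to `j`, the transposition turns the stretch from `π i`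
to `j` into a cycle of its own, and this stretch does not contain `i`. -/
lemma not_sameCycle_mul_swap_of_sameCycle {π : Perm α} {i j : α} (h : π.SameCycle i j)
    (hij : i ≠ j) : ¬ (π * swap i j).SameCycle i j := by
  classical
  have hex : ∃ n : ℕ, (π ^ n) i = j := h.exists_nat_pow_eq
  obtain ⟨n, hn, hmin⟩ : ∃ n : ℕ, (π ^ n) i = j ∧ ∀ m < n, (π ^ m) i ≠ j :=
    ⟨Nat.find hex, Nat.find_spec hex, fun m hm => Nat.find_min hex hm⟩
  have hn0 : 0 < n := by
    rcases Nat.eq_zero_or_pos n with rfl | h0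
    · exact absurd (by simpa using hn) hij
    · exact h0
  intro hs
  have key : ∀ m : ℕ, ∃ k, 0 < k ∧ k ≤ n ∧ ((π * swap i j) ^ m) j = (π ^ k) i := by
    intro m
    induction m with
    | zero => exact ⟨n, hn0, le_rfl, by simp [hn]⟩
    | succ m ih =>
      obtain ⟨k, hk0, hkn, hk⟩ := ih
      rw [pow_succ', mul_apply, hk]
      by_cases hkn' : k = n
      · subst hkn'
        exact ⟨1, one_pos, hk0, by rw [hn, mul_apply, swap_apply_right, pow_one]⟩
      · have hk1 : (π ^ k) i ≠ j := hmin k (by omega)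
        have hk2 : (π ^ k) i ≠ i := by
          intro h0
          apply hmin (n - k) (by omega)
          nth_rewrite 1 [← h0]
          rw [← mul_apply, ← pow_add, Nat.sub_add_cancel hkn, hn]
        exact ⟨k + 1, by omega, by omega, by
          rw [mul_apply, swap_apply_of_ne_of_ne hk2 hk1, pow_succ', mul_apply]⟩
  obtain ⟨m, hm⟩ := hs.symm.exists_nat_pow_eq
  obtain ⟨k, hk0, hkn, hk⟩ := key m
  rw [hm] at hk
  by_cases hkn' : k = n
  · subst hkn'
    exact hij (hk.trans hn)
  · apply hmin (n - k) (by omega)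
    nth_rewrite 1 [hk]
    rw [← mul_apply, ← pow_add, Nat.sub_add_cancel hkn, hn]

lemma cycleCount_le_mul_swap_add_one (π : Perm α) (i j : α) :
    π.cycleCount ≤ (π * swap i j).cycleCount + 1 :=
  Setoid.card_quotient_le_add_one _ _ i j fun _ _ h => SameCycle.link_of_mul_swap h

lemma cycleCount_mul_swap_le (π : Perm α) (i j : α) :
    (π * swap i j).cycleCount ≤ π.cycleCount + 1 := by
  have := cycleCount_le_mul_swap_add_one (π * swap i j) i j
  rwa [mul_assoc, swap_mul_self, mul_one] at this

lemma cycleCount_mul_swap_lt {π : Perm α} {i j : α} (h : ¬ π.SameCycle i j) :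
    (π * swap i j).cycleCount < π.cycleCount := by
  have h' := sameCycle_mul_swap_of_not_sameCycle h
  have hle : SameCycle.setoid π ≤ SameCycle.setoid (π * swap i j) := by
    intro u v huv
    refine Setoid.link_of_rel (s := SameCycle.setoid (π * swap i j)) h' ?_
    apply SameCycle.link_of_mul_swap
    rwa [mul_assoc, swap_mul_self, mul_one]
  have hsurj : Function.Surjective (Quotient.map' id hle) := by
    rintro ⟨u⟩
    exact ⟨⟦u⟧, rfl⟩
  -- Otherwise the surjection from the old cycles to the new ones would be a bijection, although it
  -- identifies those of `i` and `j`.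
  by_contra hcon
  have hinj := (hsurj.bijective_of_nat_card_le (not_lt.1 hcon)).1
  exact h (Quotient.exact (hinj (a₁ := ⟦i⟧) (a₂ := ⟦j⟧) (Quotient.sound h')))

lemma cycleCount_lt_mul_swap {π : Perm α} {i j : α} (h : π.SameCycle i j) (hij : i ≠ j) :
    π.cycleCount < (π * swap i j).cycleCount := by
  have := cycleCount_mul_swap_lt (not_sameCycle_mul_swap_of_sameCycle h hij)
  rwa [mul_assoc, swap_mul_self, mul_one] at this

end Equiv.Perm

end CycleCount

namespace SimpleGraph

/-! ### Euler's inequality for rotation systems -/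

section EulerInequality

open Equiv Equiv.Perm

variable {V : Type*} {G : SimpleGraph V}

lemma reachable_insert_link {T : Set (Sym2 V)} {i j u v : V}
    (h : (fromEdgeSet (insert s(i, j) T)).Reachable u v) :
    (fromEdgeSet T).reachableSetoid.link i j u v := by
  obtain ⟨p⟩ := h
  induction p with
  | nil => exact Setoid.refl' _ _
  | @cons u v w h p ih =>
    refine Setoid.trans' _ ?_ ih
    rw [fromEdgeSet_adj, Set.mem_insert_iff] at h
    obtain ⟨h | h, hne⟩ := h
    · rw [Sym2.eq_iff] at h
      have hr : ∀ z, (fromEdgeSet T).reachableSetoid z z := fun z => Setoid.refl' _ _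
      rcases h with ⟨rfl, rfl⟩ | ⟨rfl, rfl⟩
      · exact Or.inr ⟨Or.inl (hr _), Or.inr (hr _)⟩
      · exact Or.inr ⟨Or.inr (hr _), Or.inl (hr _)⟩
    · exact Or.inl (Adj.reachable ((fromEdgeSet_adj _).2 ⟨h, hne⟩))

namespace RotationSystem

lemma next_fst (R : G.RotationSystem) (d : G.Dart) : (R.next d).fst = d.fst :=
  (R.sameCycle_iff _ _).1 (sameCycle_apply_left.2 (SameCycle.refl _ _))

open scoped Classical in
/-- The reversal of the darts with edge in a given set. -/
noncomputable def symmOn (G : SimpleGraph V) (T : Set (Sym2 V)) : Perm G.Dart :=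
  Function.Involutive.toPerm (fun d => if d.edge ∈ T then d.symm else d) (by
    intro d
    by_cases h : d.edge ∈ T <;> simp [h])

lemma symmOn_of_mem {T : Set (Sym2 V)} {d : G.Dart} (h : d.edge ∈ T) : symmOn G T d = d.symm :=
  if_pos h

lemma symmOn_of_notMem {T : Set (Sym2 V)} {d : G.Dart} (h : d.edge ∉ T) : symmOn G T d = d :=
  if_neg h

-- Switching on one edge multiplies the reversal by one transposition, so the faces can be built up
-- edge by edge.
open scoped Classical in
lemma symmOn_insert {T : Set (Sym2 V)} {d : G.Dart} (h : d.edge ∉ T) :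
    symmOn G (insert d.edge T) = symmOn G T * swap d d.symm := by
  ext1 e
  rw [mul_apply]
  by_cases h1 : e = d
  · subst h1
    rw [swap_apply_left, symmOn_of_mem (by simp), symmOn_of_notMem (by simpa using h)]
  by_cases h2 : e = d.symm
  · subst h2
    rw [swap_apply_right, symmOn_of_mem (by simp), symmOn_of_notMem h, Dart.symm_symm]
  rw [swap_apply_of_ne_of_ne h1 h2]
  have h3 : e.edge ≠ d.edge := by
    rw [Ne, dart_edge_eq_iff]
    tauto
  by_cases h4 : e.edge ∈ T
  · rw [symmOn_of_mem h4, symmOn_of_mem (by simp [h4])]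
  · rw [symmOn_of_notMem h4, symmOn_of_notMem (by simp [h3, h4])]

lemma faceStep_eq (R : G.RotationSystem) : R.faceStep = R.next * symmOn G Set.univ := by
  ext1 d
  rw [mul_apply, symmOn_of_mem (Set.mem_univ _)]
  rfl

instance [Finite V] : Finite G.Dart := Finite.of_injective _ (Dart.toProd_injective (G := G))

lemma reachable_of_sameCycle (R : G.RotationSystem) {T : Set (Sym2 V)} {d e : G.Dart}
    (h : (R.next * symmOn G T).SameCycle d e) : (fromEdgeSet T).Reachable d.fst e.fst := by
  refine h.rel_of_forall ((fromEdgeSet T).reachableSetoid.comap (fun d : G.Dart => d.fst))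
    (fun d => ?_)
  change (fromEdgeSet T).Reachable d.fst ((R.next * symmOn G T) d).fst
  rw [mul_apply, next_fst]
  by_cases h : d.edge ∈ T
  · rw [symmOn_of_mem h]
    exact Adj.reachable ((fromEdgeSet_adj _).2 ⟨h, d.fst_ne_snd⟩)
  · rw [symmOn_of_notMem h]

lemma card_face (R : G.RotationSystem) : Nat.card R.Face = R.faceStep.cycleCount := rfl

variable [Finite V]

/-- Induction on the set of edges whose reversal is switched on. Without edges, the cycles are the
rotations at the non-isolated vertices of `G`, at most one per vertex. An edge inside a component
adds at most one cycle, and one to the edge count. An edge between two components merges two cycles,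
since its darts cannot have shared one, and this balances the loss of at most one component, which
is counted twice. -/
lemma cycleCount_add_card_le (R : G.RotationSystem) (T : Set (Sym2 V)) (hT : T ⊆ G.edgeSet) :
    (R.next * symmOn G T).cycleCount + Nat.card V ≤
      T.ncard + 2 * Nat.card (fromEdgeSet T).ConnectedComponent := by
  classical
  induction T, T.toFinite using Set.Finite.induction_on with
  | empty =>
    have h1 : symmOn G ∅ = 1 := by
      ext1 d
      rw [symmOn_of_notMem (by simp), one_apply]
    rw [h1, mul_one, Set.ncard_empty, zero_add, two_mul]
    apply add_le_add
    · refine Nat.card_le_card_of_injective (Quotient.lift (fun d : G.Dart =>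
        (fromEdgeSet (∅ : Set (Sym2 V))).connectedComponentMk d.fst) ?_) ?_
      · intro d e h
        exact congrArg _ ((R.sameCycle_iff _ _).1 h)
      · rintro ⟨d⟩ ⟨e⟩ h
        apply Quotient.sound
        refine (R.sameCycle_iff _ _).2 ?_
        have := ConnectedComponent.exact h
        rwa [fromEdgeSet_empty, reachable_bot] at this
    · refine Nat.card_le_card_of_injective (connectedComponentMk _) ?_
      intro u v h
      have := ConnectedComponent.exact h
      rwa [fromEdgeSet_empty, reachable_bot] at this
  | @insert e T he hfin ih =>
    rw [Set.insert_subset_iff] at hT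
    have ih := ih hT.2
    obtain ⟨d, rfl⟩ : ∃ d : G.Dart, d.edge = e := by
      induction e with
      | h u v => exact ⟨⟨(u, v), hT.1⟩, rfl⟩
    rw [Set.ncard_insert_of_notMem he hfin, symmOn_insert he, ← mul_assoc]
    by_cases hr : (fromEdgeSet T).Reachable d.fst d.snd
    · have h1 := cycleCount_mul_swap_le (R.next * symmOn G T) d d.symm
      have h2 : Nat.card (fromEdgeSet T).ConnectedComponent ≤
          Nat.card (fromEdgeSet (insert d.edge T)).ConnectedComponent :=
        Setoid.card_quotient_le_of_le (s := (fromEdgeSet (insert d.edge T)).reachableSetoid)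
          (t := (fromEdgeSet T).reachableSetoid) (fun u v h =>
          Setoid.link_of_rel (s := (fromEdgeSet T).reachableSetoid) hr (reachable_insert_link h))
      omega
    · have h1 : ¬ (R.next * symmOn G T).SameCycle d d.symm := fun h =>
        hr (R.reachable_of_sameCycle h)
      have h2 := cycleCount_mul_swap_lt h1
      have h3 : Nat.card (fromEdgeSet T).ConnectedComponent ≤
          Nat.card (fromEdgeSet (insert d.edge T)).ConnectedComponent + 1 :=
        Setoid.card_quotient_le_add_one (fromEdgeSet T).reachableSetoid
          (fromEdgeSet (insert d.edge T)).reachableSetoid d.fst d.snd (fun u v h => reachable_insert_link h)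
      omega

/-- The Euler characteristic of a connected component of a combinatorial embedding is at
most two. -/
theorem card_add_card_face_le (R : G.RotationSystem) :
    Nat.card V + Nat.card R.Face ≤ Nat.card G.edgeSet + 2 * Nat.card G.ConnectedComponent := by
  have h := R.cycleCount_add_card_le G.edgeSet subset_rfl
  have h1 : symmOn G G.edgeSet = symmOn G Set.univ := by
    ext1 d
    rw [symmOn_of_mem d.edge_mem, symmOn_of_mem (Set.mem_univ _)]
  rw [h1, ← faceStep_eq, fromEdgeSet_edgeSet] at h
  rw [add_comm, Nat.card_coe_set_eq]
  exact h

/-- Euler's formula for a connected graph with at least two vertices. -/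
lemma isPlane_iff_of_connected (R : G.RotationSystem) (hG : G.Connected) [Nontrivial V] :
    R.IsPlane ↔ Nat.card V + R.faceStep.cycleCount = Nat.card G.edgeSet + 2 := by
  have h1 : Nat.card {v : V // ∀ w, ¬ G.Adj v w} = 0 := by
    rw [Nat.card_eq_zero]
    left
    constructor
    rintro ⟨v, hv⟩
    obtain ⟨w, hw⟩ := hG.preconnected.exists_adj_of_nontrivial v
    exact hv w hw
  have h2 : Nat.card G.ConnectedComponent = 1 := by
    have := hG.preconnected.subsingleton_connectedComponent
    have := hG.nonempty
    rw [Nat.card_eq_one_iff_unique]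
    exact ⟨inferInstance, inferInstance⟩
  rw [IsPlane, h1, h2, add_zero, card_face]

end RotationSystem

end EulerInequality

/-! ### Darts, degrees and edge counts of the dot product -/

section DotProductDarts

variable {V W : Type*} {G : SimpleGraph V} {H : SimpleGraph W} {a b c d : V}
  {x y a' b' c' d' : W}

/-- The data from which a dot product is formed: two independent edges `ab`, `cd` of `G` and two
adjacent cubic vertices `x`, `y` of `H` with their neighbours. -/
structure IsDotData (G : SimpleGraph V) (H : SimpleGraph W) (a b c d : V)
    (x y a' b' c' d' : W) : Prop where
  adj_ab : G.Adj a b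
  adj_cd : G.Adj c d
  ne_ac : a ≠ c
  ne_ad : a ≠ d
  ne_bc : b ≠ c
  ne_bd : b ≠ d
  adj_xy : H.Adj x y
  neighbors : H.AreOtherNeighbors x y a' b' c' d'
  ne_ab' : a' ≠ b'
  ne_cd' : c' ≠ d'
  ne_ya' : a' ≠ y
  ne_yb' : b' ≠ y
  ne_xc' : c' ≠ x
  ne_xd' : d' ≠ x

namespace IsDotData

lemma adj_xa' (D : IsDotData G H a b c d x y a' b' c' d') : H.Adj x a' :=
  D.neighbors.adj_left.2 (Or.inl rfl)

lemma adj_xb' (D : IsDotData G H a b c d x y a' b' c' d') : H.Adj x b' :=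
  D.neighbors.adj_left.2 (Or.inr (Or.inl rfl))

lemma adj_yc' (D : IsDotData G H a b c d x y a' b' c' d') : H.Adj y c' :=
  D.neighbors.adj_right.2 (Or.inl rfl)

lemma adj_yd' (D : IsDotData G H a b c d x y a' b' c' d') : H.Adj y d' :=
  D.neighbors.adj_right.2 (Or.inr (Or.inl rfl))

end IsDotData

open scoped Classical in
/-- The other end of the edge `ab` or `cd` at `u`. -/
noncomputable def dotMate (a b c d u : V) : V :=
  if u = a then b else if u = b then a else if u = c then d else c

open scoped Classical in
/-- The deleted vertex of `H` whose neighbour becomes a neighbour of `u`. -/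
noncomputable def dotAnchor (a b : V) (x y : W) (u : V) : W :=
  if u = a ∨ u = b then x else y

lemma IsDotData.adj_dotMate (D : IsDotData G H a b c d x y a' b' c' d') {u : V}
    {w : {w : W | w ≠ x ∧ w ≠ y}}
    (h : (G.dotProduct H a b c d x y a' b' c' d').Adj (Sum.inl u) (Sum.inr w)) :
    G.Adj u (dotMate a b c d u) := by
  have := D.adj_ab.ne
  have := D.adj_cd.ne
  have := D.ne_ac
  have := D.ne_ad
  have := D.ne_bc
  have := D.ne_bd
  have := D.adj_ab.symm
  have := D.adj_cd.symm
  rcases dotProduct_adj_inl_inr.1 h with ⟨rfl, -⟩ | ⟨rfl, -⟩ | ⟨rfl, -⟩ | ⟨rfl, -⟩ <;>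
    simp only [dotMate] <;> split_ifs <;> first | exact D.adj_ab | exact D.adj_cd | simp_all

lemma IsDotData.adj_dotAnchor (D : IsDotData G H a b c d x y a' b' c' d') {u : V}
    {w : {w : W | w ≠ x ∧ w ≠ y}}
    (h : (G.dotProduct H a b c d x y a' b' c' d').Adj (Sum.inr w) (Sum.inl u)) :
    H.Adj w.1 (dotAnchor a b x y u) := by
  have := D.ne_ac.symm
  have := D.ne_ad.symm
  have := D.ne_bc.symm
  have := D.ne_bd.symm
  have := D.adj_xa'.symm
  have := D.adj_xb'.symm
  have := D.adj_yc'.symm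
  have := D.adj_yd'.symm
  rcases dotProduct_adj_inr_inl.1 h with ⟨rfl, hw⟩ | ⟨rfl, hw⟩ | ⟨rfl, hw⟩ | ⟨rfl, hw⟩ <;>
    rw [hw] <;> simp_all [dotAnchor]

/-- The darts of the dot product correspond to those darts of the factors that do not leave one
of the two deleted vertices. -/
noncomputable def IsDotData.dartFun (D : IsDotData G H a b c d x y a' b' c' d') :
    (G.dotProduct H a b c d x y a' b' c' d').Dart →
      G.Dart ⊕ {e : H.Dart // e.fst ≠ x ∧ e.fst ≠ y}
  | ⟨(Sum.inl u, Sum.inl v), h⟩ =>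
    Sum.inl ⟨(u, v), (deleteEdges_le _) (dotProduct_adj_inl_inl.1 h)⟩
  | ⟨(Sum.inl u, Sum.inr _), h⟩ => Sum.inl ⟨(u, dotMate a b c d u), D.adj_dotMate h⟩
  | ⟨(Sum.inr w, Sum.inl u), h⟩ =>
    Sum.inr ⟨⟨(w.1, dotAnchor a b x y u), D.adj_dotAnchor h⟩, w.2⟩
  | ⟨(Sum.inr w, Sum.inr w'), h⟩ => Sum.inr ⟨⟨(w.1, w'.1), dotProduct_adj_inr_inr.1 h⟩, w.2⟩

lemma IsDotData.dartFun_inl_inr (D : IsDotData G H a b c d x y a' b' c' d') {u v : V}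
    {w : {w : W | w ≠ x ∧ w ≠ y}} (huv : G.Adj u v)
    (h : (G.dotProduct H a b c d x y a' b' c' d').Adj (Sum.inl u) (Sum.inr w))
    (hv : dotMate a b c d u = v) :
    D.dartFun ⟨(Sum.inl u, Sum.inr w), h⟩ = Sum.inl ⟨(u, v), huv⟩ := by
  subst hv; rfl

lemma IsDotData.dartFun_inr_inl (D : IsDotData G H a b c d x y a' b' c' d') {u : V} {z : W}
    {w : {w : W | w ≠ x ∧ w ≠ y}} (hwz : H.Adj w z)
    (h : (G.dotProduct H a b c d x y a' b' c' d').Adj (Sum.inr w) (Sum.inl u))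
    (hz : dotAnchor a b x y u = z) :
    D.dartFun ⟨(Sum.inr w, Sum.inl u), h⟩ = Sum.inr ⟨⟨(w.1, z), hwz⟩, w.2⟩ := by
  subst hz; rfl

lemma dotMate_a : dotMate a b c d a = b := by simp [dotMate]

lemma IsDotData.dotMate_b (D : IsDotData G H a b c d x y a' b' c' d') :
    dotMate a b c d b = a := by simp [dotMate, D.adj_ab.ne']

lemma IsDotData.dotMate_c (D : IsDotData G H a b c d x y a' b' c' d') :
    dotMate a b c d c = d := by simp [dotMate, D.ne_ac.symm, D.ne_bc.symm]

lemma IsDotData.dotMate_d (D : IsDotData G H a b c d x y a' b' c' d') :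
    dotMate a b c d d = c := by simp [dotMate, D.ne_ad.symm, D.ne_bd.symm, D.adj_cd.ne']

lemma dotAnchor_a : dotAnchor a b x y a = x := by simp [dotAnchor]

lemma dotAnchor_b : dotAnchor a b x y b = x := by simp [dotAnchor]

lemma IsDotData.dotAnchor_c (D : IsDotData G H a b c d x y a' b' c' d') :
    dotAnchor a b x y c = y := by simp [dotAnchor, D.ne_ac.symm, D.ne_bc.symm]

lemma IsDotData.dotAnchor_d (D : IsDotData G H a b c d x y a' b' c' d') :
    dotAnchor a b x y d = y := by simp [dotAnchor, D.ne_ad.symm, D.ne_bd.symm]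

lemma IsDotData.edge_dotMate (D : IsDotData G H a b c d x y a' b' c' d') {u : V}
    {w : {w : W | w ≠ x ∧ w ≠ y}}
    (h : (G.dotProduct H a b c d x y a' b' c' d').Adj (Sum.inl u) (Sum.inr w)) :
    s(u, dotMate a b c d u) ∈ ({s(a, b), s(c, d)} : Set (Sym2 V)) := by
  rcases dotProduct_adj_inl_inr.1 h with ⟨rfl, -⟩ | ⟨rfl, -⟩ | ⟨rfl, -⟩ | ⟨rfl, -⟩
  · rw [dotMate_a]; simp
  · rw [D.dotMate_b]; simp
  · rw [D.dotMate_c]; simp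
  · rw [D.dotMate_d]; simp

lemma IsDotData.dartFun_injective (D : IsDotData G H a b c d x y a' b' c' d') :
    Function.Injective D.dartFun := by
  rintro ⟨⟨u | w, v | z⟩, h⟩ ⟨⟨u' | w', v' | z'⟩, h'⟩ heq <;>
    simp only [dartFun, Sum.inl.injEq, Sum.inr.injEq, Dart.mk.injEq, Prod.mk.injEq,
      Subtype.mk.injEq, reduceCtorEq] at heq
  · simp [heq.1, heq.2]
  · exfalso
    obtain ⟨rfl, rfl⟩ := heq
    have := dotProduct_adj_inl_inl.1 h
    rw [deleteEdges_adj] at this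
    exact this.2 (D.edge_dotMate h')
  · exfalso
    obtain ⟨rfl, rfl⟩ := heq
    have := dotProduct_adj_inl_inl.1 h'
    rw [deleteEdges_adj] at this
    exact this.2 (D.edge_dotMate h)
  · obtain ⟨rfl, -⟩ := heq
    have h1 := dotProduct_adj_inl_inr.1 h
    have h2 := dotProduct_adj_inl_inr.1 h'
    have : z = z' := by
      apply Subtype.ext
      have := D.adj_ab.ne
      have := D.adj_cd.ne
      have := D.ne_ac
      have := D.ne_ad
      have := D.ne_bc
      have := D.ne_bd
      grind
    rw [Dart.mk.injEq, this]
  · obtain ⟨hw, h3⟩ := heq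
    obtain rfl := Subtype.ext hw
    have h1 := dotProduct_adj_inr_inl.1 h
    have h2 := dotProduct_adj_inr_inl.1 h'
    -- A vertex of `H` may be a neighbour of both `x` and `y`, for instance if `a' = c'`; the anchor
    -- then tells its two new edges apart. New edges with the same anchor have different ends in
    -- `H`.
    have : v = v' := by
      have := D.ne_ab'
      have := D.ne_cd'
      have := D.adj_xy.ne
      rcases h1 with ⟨rfl, h1⟩ | ⟨rfl, h1⟩ | ⟨rfl, h1⟩ | ⟨rfl, h1⟩ <;>
        rcases h2 with ⟨rfl, h2⟩ | ⟨rfl, h2⟩ | ⟨rfl, h2⟩ | ⟨rfl, h2⟩ <;>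
        simp only [dotAnchor_a, dotAnchor_b, D.dotAnchor_c, D.dotAnchor_d] at h3 <;> grind
    rw [Dart.mk.injEq, this]
  · exfalso
    obtain ⟨hw, h3⟩ := heq
    have := z'.2
    rw [← h3] at this
    simp only [dotAnchor] at this
    split_ifs at this <;> simp at this
  · exfalso
    obtain ⟨hw, h3⟩ := heq
    have := z.2
    rw [h3] at this
    simp only [dotAnchor] at this
    split_ifs at this <;> simp at this
  · rw [Dart.mk.injEq, Subtype.ext heq.1, Subtype.ext heq.2]

lemma IsDotData.dartFun_surjective (D : IsDotData G H a b c d x y a' b' c' d') :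
    Function.Surjective D.dartFun := by
  rintro (⟨⟨u, v⟩, h⟩ | ⟨⟨⟨w, z⟩, h⟩, hw⟩)
  · simp only at h
    by_cases h1 : s(u, v) ∈ ({s(a, b), s(c, d)} : Set (Sym2 V))
    · rw [Set.mem_insert_iff, Set.mem_singleton_iff, Sym2.eq_iff, Sym2.eq_iff] at h1
      rcases h1 with (⟨rfl, rfl⟩ | ⟨rfl, rfl⟩) | (⟨rfl, rfl⟩ | ⟨rfl, rfl⟩)
      · exact ⟨⟨(Sum.inl u, Sum.inr ⟨a', D.adj_xa'.ne', D.ne_ya'⟩),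
          dotProduct_adj_inl_inr.2 (by simp)⟩, D.dartFun_inl_inr h _ dotMate_a⟩
      · exact ⟨⟨(Sum.inl u, Sum.inr ⟨b', D.adj_xb'.ne', D.ne_yb'⟩),
          dotProduct_adj_inl_inr.2 (by simp)⟩, D.dartFun_inl_inr h _ D.dotMate_b⟩
      · exact ⟨⟨(Sum.inl u, Sum.inr ⟨c', D.ne_xc', D.adj_yc'.ne'⟩),
          dotProduct_adj_inl_inr.2 (by simp)⟩, D.dartFun_inl_inr h _ D.dotMate_c⟩
      · exact ⟨⟨(Sum.inl u, Sum.inr ⟨d', D.ne_xd', D.adj_yd'.ne'⟩),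
          dotProduct_adj_inl_inr.2 (by simp)⟩, D.dartFun_inl_inr h _ D.dotMate_d⟩
    · exact ⟨⟨(Sum.inl u, Sum.inl v), dotProduct_adj_inl_inl.2 (deleteEdges_adj.2 ⟨h, h1⟩)⟩, rfl⟩
  · simp only at h hw
    by_cases hx : z = x
    · subst hx
      rcases D.neighbors.adj_left.1 h.symm with rfl | rfl | rfl
      · exact ⟨⟨(Sum.inr ⟨w, hw⟩, Sum.inl a), dotProduct_adj_inr_inl.2 (by simp)⟩,
          D.dartFun_inr_inl (w := ⟨w, hw⟩) h _ dotAnchor_a⟩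
      · exact ⟨⟨(Sum.inr ⟨w, hw⟩, Sum.inl b), dotProduct_adj_inr_inl.2 (by simp)⟩,
          D.dartFun_inr_inl (w := ⟨w, hw⟩) h _ dotAnchor_b⟩
      · exact absurd rfl hw.2
    by_cases hy : z = y
    · subst hy
      rcases D.neighbors.adj_right.1 h.symm with rfl | rfl | rfl
      · exact ⟨⟨(Sum.inr ⟨w, hw⟩, Sum.inl c), dotProduct_adj_inr_inl.2 (by simp)⟩,
          D.dartFun_inr_inl (w := ⟨w, hw⟩) h _ D.dotAnchor_c⟩
      · exact ⟨⟨(Sum.inr ⟨w, hw⟩, Sum.inl d), dotProduct_adj_inr_inl.2 (by simp)⟩,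
          D.dartFun_inr_inl (w := ⟨w, hw⟩) h _ D.dotAnchor_d⟩
      · exact absurd rfl hw.1
    exact ⟨⟨(Sum.inr ⟨w, hw⟩, Sum.inr ⟨z, hx, hy⟩), dotProduct_adj_inr_inr.2 h⟩, rfl⟩

/-- The darts of the dot product correspond to those darts of the factors that do not leave one
of the two deleted vertices. -/
noncomputable def IsDotData.dartEquiv (D : IsDotData G H a b c d x y a' b' c' d') :
    (G.dotProduct H a b c d x y a' b' c' d').Dart ≃
      G.Dart ⊕ {e : H.Dart // e.fst ≠ x ∧ e.fst ≠ y} :=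
  Equiv.ofBijective D.dartFun ⟨D.dartFun_injective, D.dartFun_surjective⟩

/-- The initial vertex of a dart in one of the factors, as a vertex of the dot product. -/
def dotFst (x y : W) :
    G.Dart ⊕ {e : H.Dart // e.fst ≠ x ∧ e.fst ≠ y} → V ⊕ {w : W | w ≠ x ∧ w ≠ y} :=
  Sum.map (fun e => e.fst) (fun e => ⟨e.1.fst, e.2⟩)

lemma IsDotData.dotFst_dartEquiv (D : IsDotData G H a b c d x y a' b' c' d')
    (e : (G.dotProduct H a b c d x y a' b' c' d').Dart) :
    dotFst x y (D.dartEquiv e) = e.fst := by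
  rcases e with ⟨⟨u | w, v | z⟩, h⟩ <;> rfl

lemma ncard_neighborSet (v : V) : (G.neighborSet v).ncard = {e : G.Dart | e.fst = v}.ncard := by
  symm
  refine Set.ncard_congr (fun e _ => e.snd) ?_ ?_ ?_
  · rintro e rfl
    exact e.adj
  · rintro ⟨⟨u, w⟩, h⟩ ⟨⟨u', w'⟩, h'⟩ h1 h2 h3
    simp only [Set.mem_ofPred_eq] at h1 h2 h3
    subst h1; subst h2; subst h3
    rfl
  · intro w hw
    exact ⟨⟨(v, w), hw⟩, rfl, rfl⟩

/-- Degrees count darts by initial vertex, and the bijection of darts preserves initial vertices. -/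
lemma IsDotData.ncard_neighborSet_inl (D : IsDotData G H a b c d x y a' b' c' d') (v : V) :
    ((G.dotProduct H a b c d x y a' b' c' d').neighborSet (Sum.inl v)).ncard =
      (G.neighborSet v).ncard := by
  rw [ncard_neighborSet, ncard_neighborSet,
    ← Set.ncard_image_of_injective _ D.dartEquiv.injective,
    ← Set.ncard_image_of_injective {e : G.Dart | e.fst = v}
      (Sum.inl_injective (β := {e : H.Dart // e.fst ≠ x ∧ e.fst ≠ y}))]
  congr 1
  ext e
  obtain ⟨e, rfl⟩ := D.dartEquiv.surjective e
  rw [D.dartEquiv.injective.mem_set_image, Set.mem_ofPred_eq, ← D.dotFst_dartEquiv]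
  rcases D.dartEquiv e with e | e <;> simp [dotFst]

lemma IsDotData.ncard_neighborSet_inr (D : IsDotData G H a b c d x y a' b' c' d')
    (v : {w : W | w ≠ x ∧ w ≠ y}) :
    ((G.dotProduct H a b c d x y a' b' c' d').neighborSet (Sum.inr v)).ncard =
      (H.neighborSet v.1).ncard := by
  have hv : {e : H.Dart | e.fst = v.1} =
      Subtype.val '' {e : {e : H.Dart // e.fst ≠ x ∧ e.fst ≠ y} | e.1.fst = v.1} := by
    ext e
    simp only [Set.mem_image, Set.mem_ofPred_eq, Subtype.exists]
    refine ⟨fun h => ⟨e, h ▸ v.2, h, rfl⟩, ?_⟩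
    rintro ⟨e, -, h, rfl⟩
    exact h
  rw [ncard_neighborSet, ncard_neighborSet,
    ← Set.ncard_image_of_injective _ D.dartEquiv.injective, hv,
    Set.ncard_image_of_injective _ Subtype.val_injective,
    ← Set.ncard_image_of_injective _ (Sum.inr_injective (α := G.Dart)
      (β := {e : H.Dart // e.fst ≠ x ∧ e.fst ≠ y}))]
  congr 1
  ext e
  obtain ⟨e, rfl⟩ := D.dartEquiv.surjective e
  rw [D.dartEquiv.injective.mem_set_image, Set.mem_ofPred_eq, ← D.dotFst_dartEquiv]
  rcases D.dartEquiv e with e | e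
  · simp [dotFst]
  · simp only [dotFst, Sum.map_inr, Sum.inr.injEq, Subtype.ext_iff,
      Sum.inr_injective.mem_set_image, Set.mem_ofPred_eq]

theorem IsDotData.isCubic (D : IsDotData G H a b c d x y a' b' c' d') (hG : G.IsCubic)
    (hH : H.IsCubic) : (G.dotProduct H a b c d x y a' b' c' d').IsCubic := by
  rintro (v | w)
  · rw [IsCubicVertex, D.ncard_neighborSet_inl]
    exact hG v
  · rw [IsCubicVertex, D.ncard_neighborSet_inr]
    exact hH w.1

lemma card_dart_eq [Finite V] : Nat.card G.Dart = 2 * Nat.card G.edgeSet := by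
  classical
  have := Fintype.ofFinite V
  rw [Nat.card_eq_fintype_card, dart_card_eq_twice_card_edges, Nat.card_eq_fintype_card,
    edgeFinset_card]

lemma card_dart_subtype_add_six [Finite W] (hxy : x ≠ y) (hx : H.IsCubicVertex x)
    (hy : H.IsCubicVertex y) :
    Nat.card {e : H.Dart // e.fst ≠ x ∧ e.fst ≠ y} + 6 = Nat.card H.Dart := by
  have h1 : Nat.card {e : H.Dart // e.fst ≠ x ∧ e.fst ≠ y} =
      ({e : H.Dart | e.fst = x} ∪ {e : H.Dart | e.fst = y})ᶜ.ncard := by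
    rw [← Nat.card_coe_set_eq]
    apply Nat.card_congr
    apply Equiv.subtypeEquivRight
    intro e
    simp
  have h2 : ({e : H.Dart | e.fst = x} ∪ {e : H.Dart | e.fst = y}).ncard = 6 := by
    rw [Set.ncard_union_eq _ (Set.toFinite _) (Set.toFinite _), ← ncard_neighborSet,
      ← ncard_neighborSet, hx, hy]
    rw [Set.disjoint_left]
    rintro e h h'
    exact hxy (h.symm.trans h')
  rw [h1, ← h2, add_comm, Set.ncard_add_ncard_compl]

/-- Only the six darts leaving `x` or `y` have no counterpart in the dot product. -/
lemma IsDotData.card_edgeSet [Finite V] [Finite W] (D : IsDotData G H a b c d x y a' b' c' d')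
    (hx : H.IsCubicVertex x) (hy : H.IsCubicVertex y) :
    Nat.card (G.dotProduct H a b c d x y a' b' c' d').edgeSet + 3 =
      Nat.card G.edgeSet + Nat.card H.edgeSet := by
  have h1 := Nat.card_congr D.dartEquiv
  rw [Nat.card_sum] at h1
  have h2 := card_dart_subtype_add_six D.adj_xy.ne hx hy
  rw [card_dart_eq] at h1 h2
  rw [card_dart_eq] at h1
  omega

lemma card_dotProduct_vertices [Finite V] [Finite W] (hxy : x ≠ y) :
    Nat.card (V ⊕ {w : W | w ≠ x ∧ w ≠ y}) + 2 = Nat.card V + Nat.card W := by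
  have h1 : ({x, y} : Set W).ncard = 2 := Set.ncard_pair hxy
  have h2 : {w : W | w ≠ x ∧ w ≠ y} = ({x, y} : Set W)ᶜ := by ext; simp
  have h3 := Set.ncard_add_ncard_compl ({x, y} : Set W)
  rw [Nat.card_sum, Nat.card_coe_set_eq, h2]
  omega

end DotProductDarts

end SimpleGraph

/-! ### Cycle counts under conjugation and under five transpositions -/

section CyclePermutations

open Equiv Equiv.Perm

variable {α β : Type*}

lemma Equiv.Perm.SameCycle.map {f : Perm α} {g : Perm β} (φ : α → β)
    (h : ∀ u, φ (f u) = g (φ u)) {u v : α} (huv : f.SameCycle u v) : g.SameCycle (φ u) (φ v) :=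
  huv.rel_of_forall ((SameCycle.setoid g).comap φ) (fun d => by
    change g.SameCycle (φ d) (φ (f d))
    rw [h]
    exact sameCycle_apply_right.2 (SameCycle.refl _ _))

lemma Equiv.Perm.sameCycle_permCongr (e : α ≃ β) {f : Perm α} {u v : β} :
    (e.permCongr f).SameCycle u v ↔ f.SameCycle (e.symm u) (e.symm v) := by
  refine ⟨fun h => h.map e.symm (fun u => by simp), fun h => ?_⟩
  have := h.map (g := e.permCongr f) e (fun u => by simp)
  simpa using this

lemma Equiv.Perm.cycleCount_permCongr (e : α ≃ β) (f : Perm α) :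
    (e.permCongr f).cycleCount = f.cycleCount := by
  refine Nat.card_congr (Quotient.congr e.symm fun u v => ?_)
  exact sameCycle_permCongr e

lemma Equiv.Perm.SameCycle.mem_of_forall {π : Perm α} {S : Set α} [Finite α] {u v : α}
    (h : π.SameCycle u v) (hS : ∀ d ∈ S, π d ∈ S) (hu : u ∈ S) : v ∈ S := by
  obtain ⟨n, rfl⟩ := h.exists_nat_pow_eq
  induction n with
  | zero => exact hu
  | succ n ih =>
    rw [pow_succ', mul_apply]
    exact hS _ (ih ⟨n, by simp⟩)

/-- If `σ` matches `p, q, r, s` with `P, Q, R, S`, then this is the permutation that exchanges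
`P` with `Q` and `R` with `S`, permutes `p, q, r, s` cyclically and agrees with `σ` elsewhere. -/
def Equiv.Perm.unsplice [DecidableEq α] (σ : Perm α) (p q r s P Q R S : α) : Perm α :=
  σ * swap r S * swap p Q * swap P s * swap q R * swap P R

/-- Undo the five transpositions one at a time, starting with `swap P R`: as `P` and `R` share a
cycle, that step gains a cycle, and the other four together gain at most four more. Without the
common cycle the bound would be five instead of three. -/
lemma Equiv.Perm.cycleCount_mul_unsplice_le [DecidableEq α] [Finite α] (N σ : Perm α)
    {p q r s P Q R S : α} (hPR : P ≠ R)
    (h : (N * σ.unsplice p q r s P Q R S).SameCycle P R) :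
    (N * σ.unsplice p q r s P Q R S).cycleCount ≤ (N * σ).cycleCount + 3 := by
  have h0 := cycleCount_lt_mul_swap h hPR
  have h1 : N * σ.unsplice p q r s P Q R S * swap P R =
      N * σ * swap r S * swap p Q * swap P s * swap q R := by
    simp only [unsplice, mul_assoc, swap_mul_self, mul_one]
  rw [h1] at h0
  have h2 := cycleCount_mul_swap_le (N * σ) r S
  have h3 := cycleCount_mul_swap_le (N * σ * swap r S) p Q
  have h4 := cycleCount_mul_swap_le (N * σ * swap r S * swap p Q) P s
  have h5 := cycleCount_mul_swap_le (N * σ * swap r S * swap p Q * swap P s) q R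
  omega

end CyclePermutations

/-! ### Values of the modified matching -/

section Unsplice

open Equiv Equiv.Perm

variable {α : Type*} [DecidableEq α]

/-- The eight elements are distinct and `σ` matches `p, q, r, s` with `P, Q, R, S`. -/
structure Equiv.Perm.IsMatching (σ : Perm α) (p q r s P Q R S : α) : Prop where
  nodup : [p, q, r, s, P, Q, R, S].Nodup
  map_p : σ p = P
  map_q : σ q = Q
  map_r : σ r = R
  map_s : σ s = S
  map_P : σ P = p
  map_Q : σ Q = q
  map_R : σ R = r
  map_S : σ S = s

namespace Equiv.Perm.IsMatching

variable {σ : Perm α} {p q r s P Q R S : α}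

/-- The transpositions, applied from right to left, carry each of the eight elements to the partner
under `σ` of its intended image; here `p` goes to `Q`, and `σ` takes `Q` to `q`. -/
lemma unsplice_p (h : σ.IsMatching p q r s P Q R S) : σ.unsplice p q r s P Q R S p = q := by
  have := h.nodup
  have := h.map_Q
  simp only [unsplice, mul_apply, swap_apply_def]
  grind

lemma unsplice_q (h : σ.IsMatching p q r s P Q R S) : σ.unsplice p q r s P Q R S q = r := by
  have := h.nodup
  have := h.map_R
  simp only [unsplice, mul_apply, swap_apply_def]
  grind

lemma unsplice_r (h : σ.IsMatching p q r s P Q R S) : σ.unsplice p q r s P Q R S r = s := by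
  have := h.nodup
  have := h.map_S
  simp only [unsplice, mul_apply, swap_apply_def]
  grind

lemma unsplice_s (h : σ.IsMatching p q r s P Q R S) : σ.unsplice p q r s P Q R S s = p := by
  have := h.nodup
  have := h.map_P
  simp only [unsplice, mul_apply, swap_apply_def]
  grind

lemma unsplice_P (h : σ.IsMatching p q r s P Q R S) : σ.unsplice p q r s P Q R S P = Q := by
  have := h.nodup
  have := h.map_q
  simp only [unsplice, mul_apply, swap_apply_def]
  grind

lemma unsplice_Q (h : σ.IsMatching p q r s P Q R S) : σ.unsplice p q r s P Q R S Q = P := by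
  have := h.nodup
  have := h.map_p
  simp only [unsplice, mul_apply, swap_apply_def]
  grind

lemma unsplice_R (h : σ.IsMatching p q r s P Q R S) : σ.unsplice p q r s P Q R S R = S := by
  have := h.nodup
  have := h.map_s
  simp only [unsplice, mul_apply, swap_apply_def]
  grind

lemma unsplice_S (h : σ.IsMatching p q r s P Q R S) : σ.unsplice p q r s P Q R S S = R := by
  have := h.nodup
  have := h.map_r
  simp only [unsplice, mul_apply, swap_apply_def]
  grind

lemma unsplice_of_notMem {z : α} (h : z ∉ [p, q, r, s, P, Q, R, S]) :
    σ.unsplice p q r s P Q R S z = σ z := by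
  simp only [unsplice, mul_apply, swap_apply_def]
  grind

end Equiv.Perm.IsMatching

end Unsplice

namespace SimpleGraph

/-! ### Plane embedding of the dot product -/

section DotProductPlanar

open Equiv Equiv.Perm

variable {V W : Type*} {G : SimpleGraph V} {H : SimpleGraph W} {a b c d : V}
  {x y a' b' c' d' : W}

/-- The rotation at the vertices of the factors that are not deleted. -/
def dotNext (RG : G.RotationSystem) (RH : H.RotationSystem) (x y : W) :
    Perm (G.Dart ⊕ {e : H.Dart // e.fst ≠ x ∧ e.fst ≠ y}) :=
  Equiv.sumCongr RG.next (RH.next.subtypePerm (p := fun e => e.fst ≠ x ∧ e.fst ≠ y)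
    (fun e => by rw [RH.next_fst]))

lemma dotNext_sameCycle_iff [Finite W] (RG : G.RotationSystem) (RH : H.RotationSystem)
    (e f : G.Dart ⊕ {e : H.Dart // e.fst ≠ x ∧ e.fst ≠ y}) :
    (dotNext RG RH x y).SameCycle e f ↔ dotFst x y e = dotFst x y f := by
  constructor
  · intro h
    refine h.rel_of_forall ((⊥ : Setoid _).comap (dotFst x y)) (fun z => ?_)
    change dotFst x y z = dotFst x y (dotNext RG RH x y z)
    rcases z with z | z
    · simp [dotNext, dotFst, RG.next_fst]
    · simp [dotNext, dotFst, RH.next_fst]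
  · intro h
    rcases e with e | e <;> rcases f with f | f <;> simp only [dotFst, Sum.map_inl, Sum.map_inr,
      Sum.inl.injEq, Sum.inr.injEq, reduceCtorEq] at h
    · exact ((RG.sameCycle_iff _ _).2 h).map (Sum.inl) (fun u => by simp [dotNext])
    · refine SameCycle.map (f := RH.next.subtypePerm (p := fun e => e.fst ≠ x ∧ e.fst ≠ y)
        (fun e => by rw [RH.next_fst])) (g := dotNext RG RH x y) Sum.inr (fun u => rfl) ?_
      rw [sameCycle_subtypePerm]
      exact (RH.sameCycle_iff _ _).2 (by simpa [Subtype.ext_iff] using h)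

namespace IsDotData

variable (D : IsDotData G H a b c d x y a' b' c' d')

/-- The embedding of the dot product obtained from embeddings of the factors. -/
noncomputable def rotationSystem [Finite W] (RG : G.RotationSystem) (RH : H.RotationSystem) :
    (G.dotProduct H a b c d x y a' b' c' d').RotationSystem where
  next := D.dartEquiv.symm.permCongr (dotNext RG RH x y)
  sameCycle_iff e f := by
    rw [sameCycle_permCongr, dotNext_sameCycle_iff, Equiv.symm_symm, D.dotFst_dartEquiv,
      D.dotFst_dartEquiv]

/-- The reversal of the darts of the dot product. -/
noncomputable def reversal : Perm (G.Dart ⊕ {e : H.Dart // e.fst ≠ x ∧ e.fst ≠ y}) :=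
  D.dartEquiv.permCongr (Function.Involutive.toPerm Dart.symm Dart.symm_involutive)

lemma cycleCount_faceStep [Finite W] (RG : G.RotationSystem) (RH : H.RotationSystem) :
    (D.rotationSystem RG RH).faceStep.cycleCount =
      (dotNext RG RH x y * D.reversal).cycleCount := by
  rw [← cycleCount_permCongr D.dartEquiv]
  congr 1
  ext1 z
  simp [RotationSystem.faceStep, rotationSystem, reversal]

lemma reversal_apply {e f : G.Dart ⊕ {e : H.Dart // e.fst ≠ x ∧ e.fst ≠ y}}
    (k : (G.dotProduct H a b c d x y a' b' c' d').Dart) (he : D.dartFun k = e)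
    (hf : D.dartFun k.symm = f) : D.reversal e = f ∧ D.reversal f = e := by
  have he' : D.dartEquiv k = e := he
  have hf' : D.dartEquiv k.symm = f := hf
  rw [← he', ← hf']
  simp [reversal]

lemma reversal_inl {e : G.Dart} (h : e.edge ∉ ({s(a, b), s(c, d)} : Set (Sym2 V))) :
    D.reversal (Sum.inl e) = Sum.inl e.symm := by
  obtain ⟨⟨u, v⟩, he⟩ := e
  exact (D.reversal_apply ⟨(Sum.inl u, Sum.inl v),
    dotProduct_adj_inl_inl.2 (deleteEdges_adj.2 ⟨he, h⟩)⟩ rfl rfl).1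

lemma reversal_inr {e : {e : H.Dart // e.fst ≠ x ∧ e.fst ≠ y}}
    (h : e.1.snd ≠ x ∧ e.1.snd ≠ y) :
    D.reversal (Sum.inr e) = Sum.inr ⟨e.1.symm, h⟩ := by
  obtain ⟨⟨⟨u, v⟩, he⟩, he'⟩ := e
  exact (D.reversal_apply ⟨(Sum.inr ⟨u, he'⟩, Sum.inr ⟨v, h⟩),
    dotProduct_adj_inr_inr.2 he⟩ rfl rfl).1

/-- The dart from `a'` to `x`. -/
def dartA : {e : H.Dart // e.fst ≠ x ∧ e.fst ≠ y} :=
  ⟨⟨(a', x), D.adj_xa'.symm⟩, D.adj_xa'.ne', D.ne_ya'⟩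

/-- The dart from `b'` to `x`. -/
def dartB : {e : H.Dart // e.fst ≠ x ∧ e.fst ≠ y} :=
  ⟨⟨(b', x), D.adj_xb'.symm⟩, D.adj_xb'.ne', D.ne_yb'⟩

/-- The dart from `c'` to `y`. -/
def dartC : {e : H.Dart // e.fst ≠ x ∧ e.fst ≠ y} :=
  ⟨⟨(c', y), D.adj_yc'.symm⟩, D.ne_xc', D.adj_yc'.ne'⟩

/-- The dart from `d'` to `y`. -/
def dartD : {e : H.Dart // e.fst ≠ x ∧ e.fst ≠ y} :=
  ⟨⟨(d', y), D.adj_yd'.symm⟩, D.ne_xd', D.adj_yd'.ne'⟩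

/-- Reversal along the new edge `aa'` exchanges the darts that stand for `(a, b)` and `(a', x)`, and
likewise for the other three. -/
lemma isMatching_reversal : D.reversal.IsMatching (Sum.inr D.dartA) (Sum.inr D.dartB)
    (Sum.inr D.dartC) (Sum.inr D.dartD) (Sum.inl ⟨(a, b), D.adj_ab⟩)
    (Sum.inl ⟨(b, a), D.adj_ab.symm⟩) (Sum.inl ⟨(c, d), D.adj_cd⟩)
    (Sum.inl ⟨(d, c), D.adj_cd.symm⟩) := by
  have hA := D.reversal_apply ⟨(Sum.inl a, Sum.inr ⟨a', D.adj_xa'.ne', D.ne_ya'⟩),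
    dotProduct_adj_inl_inr.2 (by simp)⟩ (D.dartFun_inl_inr D.adj_ab _ dotMate_a)
    (D.dartFun_inr_inl D.adj_xa'.symm _ dotAnchor_a)
  have hB := D.reversal_apply ⟨(Sum.inl b, Sum.inr ⟨b', D.adj_xb'.ne', D.ne_yb'⟩),
    dotProduct_adj_inl_inr.2 (by simp)⟩ (D.dartFun_inl_inr D.adj_ab.symm _ D.dotMate_b)
    (D.dartFun_inr_inl D.adj_xb'.symm _ dotAnchor_b)
  have hC := D.reversal_apply ⟨(Sum.inl c, Sum.inr ⟨c', D.ne_xc', D.adj_yc'.ne'⟩),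
    dotProduct_adj_inl_inr.2 (by simp)⟩ (D.dartFun_inl_inr D.adj_cd _ D.dotMate_c)
    (D.dartFun_inr_inl D.adj_yc'.symm _ D.dotAnchor_c)
  have hD := D.reversal_apply ⟨(Sum.inl d, Sum.inr ⟨d', D.ne_xd', D.adj_yd'.ne'⟩),
    dotProduct_adj_inl_inr.2 (by simp)⟩ (D.dartFun_inl_inr D.adj_cd.symm _ D.dotMate_d)
    (D.dartFun_inr_inl D.adj_yd'.symm _ D.dotAnchor_d)
  refine ⟨?_, hA.2, hB.2, hC.2, hD.2, hA.1, hB.1, hC.1, hD.1⟩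
  have := D.ne_ab'
  have := D.ne_cd'
  have := D.adj_ab.ne
  have := D.adj_cd.ne
  have := D.ne_ac
  have := D.ne_ad
  have := D.ne_bc
  have := D.ne_bd
  have := D.adj_xy.ne
  simp only [dartA, dartB, dartC, dartD, List.nodup_cons, List.mem_cons, List.not_mem_nil,
    Sum.inl.injEq, Sum.inr.injEq, reduceCtorEq, Subtype.mk.injEq, Dart.mk.injEq, Prod.mk.injEq]
  grind

/-- The embedding of `H` turns as required at the two deleted vertices. -/
structure IsAligned (RH : H.RotationSystem) : Prop where
  next_xy : RH.next ⟨(x, y), D.adj_xy⟩ = ⟨(x, a'), D.adj_xa'⟩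
  next_xa : RH.next ⟨(x, a'), D.adj_xa'⟩ = ⟨(x, b'), D.adj_xb'⟩
  next_xb : RH.next ⟨(x, b'), D.adj_xb'⟩ = ⟨(x, y), D.adj_xy⟩
  next_yx : RH.next ⟨(y, x), D.adj_xy.symm⟩ = ⟨(y, c'), D.adj_yc'⟩
  next_yc : RH.next ⟨(y, c'), D.adj_yc'⟩ = ⟨(y, d'), D.adj_yd'⟩
  next_yd : RH.next ⟨(y, d'), D.adj_yd'⟩ = ⟨(y, x), D.adj_xy.symm⟩

/-- The permutation of the darts whose cycles correspond to the faces of the factors. -/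
noncomputable def factorPerm [DecidableEq (G.Dart ⊕ {e : H.Dart // e.fst ≠ x ∧ e.fst ≠ y})] :
    Perm (G.Dart ⊕ {e : H.Dart // e.fst ≠ x ∧ e.fst ≠ y}) :=
  D.reversal.unsplice (Sum.inr D.dartA) (Sum.inr D.dartB)
    (Sum.inr D.dartC) (Sum.inr D.dartD) (Sum.inl ⟨(a, b), D.adj_ab⟩)
    (Sum.inl ⟨(b, a), D.adj_ab.symm⟩) (Sum.inl ⟨(c, d), D.adj_cd⟩)
    (Sum.inl ⟨(d, c), D.adj_cd.symm⟩)

variable [DecidableEq (G.Dart ⊕ {e : H.Dart // e.fst ≠ x ∧ e.fst ≠ y})]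

lemma factorPerm_inl (e : G.Dart) : D.factorPerm (Sum.inl e) = Sum.inl e.symm := by
  by_cases h : e.edge ∈ ({s(a, b), s(c, d)} : Set (Sym2 V))
  · rw [Set.mem_insert_iff, Set.mem_singleton_iff, dart_edge_eq_mk'_iff, dart_edge_eq_mk'_iff] at h
    obtain ⟨⟨u, v⟩, he⟩ := e
    simp only [Prod.mk.injEq] at h
    rcases h with (⟨rfl, rfl⟩ | ⟨rfl, rfl⟩) | (⟨rfl, rfl⟩ | ⟨rfl, rfl⟩)
    · exact D.isMatching_reversal.unsplice_P
    · exact D.isMatching_reversal.unsplice_Q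
    · exact D.isMatching_reversal.unsplice_R
    · exact D.isMatching_reversal.unsplice_S
  · rw [factorPerm, IsMatching.unsplice_of_notMem, D.reversal_inl h]
    simp only [List.mem_cons, List.not_mem_nil, reduceCtorEq, Sum.inl.injEq]
    rw [Set.mem_insert_iff, Set.mem_singleton_iff, dart_edge_eq_mk'_iff, dart_edge_eq_mk'_iff] at h
    rintro (h' | h' | h' | h' | h' | h' | h' | h' | h') <;> simp_all

lemma factorPerm_inr {e : {e : H.Dart // e.fst ≠ x ∧ e.fst ≠ y}}
    (h : e.1.snd ≠ x ∧ e.1.snd ≠ y) : D.factorPerm (Sum.inr e) = Sum.inr ⟨e.1.symm, h⟩ := by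
  rw [factorPerm, IsMatching.unsplice_of_notMem, D.reversal_inr h]
  simp only [List.mem_cons, List.not_mem_nil, reduceCtorEq, Sum.inr.injEq]
  rintro (rfl | rfl | rfl | rfl | h' | h' | h' | h' | h') <;> simp_all [dartA, dartB, dartC, dartD]

lemma dotNext_factorPerm_inl (RG : G.RotationSystem) (RH : H.RotationSystem) (e : G.Dart) :
    (dotNext RG RH x y * D.factorPerm) (Sum.inl e) = Sum.inl (RG.faceStep e) := by
  rw [mul_apply, D.factorPerm_inl]
  rfl

/-- One step along a facial walk, in a form that can be chained through the darts leaving `x` and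
`y`. -/
lemma _root_.SimpleGraph.RotationSystem.sameCycle_next_symm (RH : H.RotationSystem) {e f g : H.Dart}
    (h : RH.next e.symm = f) (hf : RH.faceStep.SameCycle f g) : RH.faceStep.SameCycle e g := by
  subst h
  exact sameCycle_apply_left.1 hf

-- On the side of `H`, a step of the modified permutation is a facial walk continued until it next
-- leaves a vertex other than `x` and `y`. With aligned rotations the walks arriving at the deleted
-- vertices go from `a'` round `x` to `b'`, from `b'` via `x` and `y` to `c'`, from `c'` round `y`
-- to `d'`, and from `d'` via `y` and `x` to `a'`; this is the cyclic permutation built into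
-- `unsplice`.
variable {D} in
lemma IsAligned.exists_dotNext_factorPerm_inr {RH : H.RotationSystem} (hRH : D.IsAligned RH)
    (RG : G.RotationSystem) (e : {e : H.Dart // e.fst ≠ x ∧ e.fst ≠ y}) :
    ∃ f : {e : H.Dart // e.fst ≠ x ∧ e.fst ≠ y},
      (dotNext RG RH x y * D.factorPerm) (Sum.inr e) = Sum.inr f ∧
        RH.faceStep.SameCycle e.1 f.1 := by
  have hdot : ∀ e f : {e : H.Dart // e.fst ≠ x ∧ e.fst ≠ y},
      D.factorPerm (Sum.inr e) = Sum.inr f → RH.faceStep.SameCycle e.1 (RH.next f.1) →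
      ∃ f : {e : H.Dart // e.fst ≠ x ∧ e.fst ≠ y},
      (dotNext RG RH x y * D.factorPerm) (Sum.inr e) = Sum.inr f ∧
        RH.faceStep.SameCycle e.1 f.1 := by
    intro e f h h'
    refine ⟨⟨RH.next f.1, by rw [RH.next_fst]; exact f.2⟩, ?_, h'⟩
    rw [mul_apply, h]
    rfl
  have hr : ∀ e, RH.faceStep.SameCycle e e := SameCycle.refl _
  by_cases hx : e.1.snd = x
  · obtain ⟨⟨⟨u, v⟩, he⟩, he'⟩ := e
    obtain rfl : v = x := hx
    rcases D.neighbors.adj_left.1 he.symm with rfl | rfl | rfl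
    · refine hdot _ _ D.isMatching_reversal.unsplice_p ?_
      exact RH.sameCycle_next_symm hRH.next_xa (RH.sameCycle_next_symm rfl (hr _))
    · refine hdot _ _ D.isMatching_reversal.unsplice_q ?_
      exact RH.sameCycle_next_symm hRH.next_xb (RH.sameCycle_next_symm hRH.next_yx
        (RH.sameCycle_next_symm rfl (hr _)))
    · exact absurd rfl he'.2
  by_cases hy : e.1.snd = y
  · obtain ⟨⟨⟨u, v⟩, he⟩, he'⟩ := e
    obtain rfl : v = y := hy
    rcases D.neighbors.adj_right.1 he.symm with rfl | rfl | rfl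
    · refine hdot _ _ D.isMatching_reversal.unsplice_r ?_
      exact RH.sameCycle_next_symm hRH.next_yc (RH.sameCycle_next_symm rfl (hr _))
    · refine hdot _ _ D.isMatching_reversal.unsplice_s ?_
      exact RH.sameCycle_next_symm hRH.next_yd (RH.sameCycle_next_symm hRH.next_xy
        (RH.sameCycle_next_symm rfl (hr _)))
    · exact absurd rfl he'.1
  exact hdot _ _ (D.factorPerm_inr ⟨hx, hy⟩) (RH.sameCycle_next_symm rfl (hr _))

-- No face of `H` is lost by dropping the darts that leave `x` or `y`: every facial walk also leaves
-- some other vertex.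
variable {D} in
omit [DecidableEq (G.Dart ⊕ {e : H.Dart // e.fst ≠ x ∧ e.fst ≠ y})] in
lemma IsAligned.exists_sameCycle {RH : H.RotationSystem} (hRH : D.IsAligned RH) (e : H.Dart) :
    ∃ f : {e : H.Dart // e.fst ≠ x ∧ e.fst ≠ y}, RH.faceStep.SameCycle e f.1 := by
  have hr : ∀ e, RH.faceStep.SameCycle e e := SameCycle.refl _
  have key : ∀ e : H.Dart, e.snd ≠ x ∧ e.snd ≠ y →
      ∃ f : {e : H.Dart // e.fst ≠ x ∧ e.fst ≠ y}, RH.faceStep.SameCycle e f.1 := by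
    intro e he
    exact ⟨⟨RH.next e.symm, by rw [RH.next_fst]; exact he⟩, RH.sameCycle_next_symm rfl (hr _)⟩
  by_cases hx : e.fst = x
  · obtain ⟨⟨u, v⟩, he⟩ := e
    obtain rfl : u = x := hx
    rcases D.neighbors.adj_left.1 he with rfl | rfl | rfl
    · exact key _ ⟨D.adj_xa'.ne', D.ne_ya'⟩
    · exact key _ ⟨D.adj_xb'.ne', D.ne_yb'⟩
    · obtain ⟨f, hf⟩ := key ⟨(v, c'), D.adj_yc'⟩ ⟨D.ne_xc', D.adj_yc'.ne'⟩
      exact ⟨f, RH.sameCycle_next_symm hRH.next_yx hf⟩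
  by_cases hy : e.fst = y
  · obtain ⟨⟨u, v⟩, he⟩ := e
    obtain rfl : u = y := hy
    rcases D.neighbors.adj_right.1 he with rfl | rfl | rfl
    · exact key _ ⟨D.ne_xc', D.adj_yc'.ne'⟩
    · exact key _ ⟨D.ne_xd', D.adj_yd'.ne'⟩
    · obtain ⟨f, hf⟩ := key ⟨(v, a'), D.adj_xa'⟩ ⟨D.adj_xa'.ne', D.ne_ya'⟩
      exact ⟨f, RH.sameCycle_next_symm hRH.next_xy hf⟩
  exact ⟨⟨e, hx, hy⟩, hr _⟩

-- Sending a dart to its face is constant on cycles of the modified permutation and reaches every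
-- face of either factor. This inequality is all that is needed, the opposite bound on faces being
-- Euler's inequality.
variable {D} in
lemma IsAligned.cycleCount_add_le [Finite V] [Finite W] {RH : H.RotationSystem}
    (hRH : D.IsAligned RH) (RG : G.RotationSystem) :
    RG.faceStep.cycleCount + RH.faceStep.cycleCount ≤
      (dotNext RG RH x y * D.factorPerm).cycleCount := by
  let φ : G.Dart ⊕ {e : H.Dart // e.fst ≠ x ∧ e.fst ≠ y} → RG.Face ⊕ RH.Face :=
    Sum.map (Quotient.mk (SameCycle.setoid RG.faceStep))
      (fun e => Quotient.mk (SameCycle.setoid RH.faceStep) e.1)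
  have hφ : ∀ u v, (dotNext RG RH x y * D.factorPerm).SameCycle u v → φ u = φ v := by
    intro u v h
    refine h.rel_of_forall ((⊥ : Setoid _).comap φ) (fun z => ?_)
    change φ z = φ ((dotNext RG RH x y * D.factorPerm) z)
    rcases z with z | z
    · rw [D.dotNext_factorPerm_inl]
      exact congrArg Sum.inl (Quotient.sound (sameCycle_apply_right.2 (SameCycle.refl _ _)))
    · obtain ⟨f, hf, hf'⟩ := hRH.exists_dotNext_factorPerm_inr RG z
      rw [hf]
      exact congrArg Sum.inr (Quotient.sound hf')
  have : Finite RG.Face := Quotient.finite _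
  have : Finite RH.Face := Quotient.finite _
  have h1 : RG.faceStep.cycleCount + RH.faceStep.cycleCount = Nat.card (RG.Face ⊕ RH.Face) := by
    rw [Nat.card_sum]; rfl
  rw [h1]
  refine Nat.card_le_card_of_surjective (Quotient.lift φ hφ) ?_
  rintro (⟨⟨e⟩⟩ | ⟨⟨e⟩⟩)
  · exact ⟨Quotient.mk _ (Sum.inl e), rfl⟩
  · obtain ⟨f, hf⟩ := hRH.exists_sameCycle e
    exact ⟨Quotient.mk _ (Sum.inr f), congrArg Sum.inr (Quotient.sound hf.symm)⟩

end IsDotData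

/-- Relative to the sums over `G` and `H`, there are two vertices and three edges fewer, and at most
three faces fewer. Adding Euler's formulas of the factors gives at least the value two for the
connected dot product, and Euler's inequality gives at most two. -/
theorem IsDotData.IsAligned.isPlanar [Finite V] [Finite W]
    {D : IsDotData G H a b c d x y a' b' c' d'} {RG : G.RotationSystem} {RH : H.RotationSystem}
    (hRH : D.IsAligned RH) (hG : RG.IsPlane) (hH : RH.IsPlane)
    (hface : RG.faceStep.SameCycle ⟨(a, b), D.adj_ab⟩ ⟨(c, d), D.adj_cd⟩)
    (hx : H.IsCubicVertex x) (hy : H.IsCubicVertex y) (hGc : G.Connected) (hHc : H.Connected)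
    (hKc : (G.dotProduct H a b c d x y a' b' c' d').Connected) :
    (G.dotProduct H a b c d x y a' b' c' d').IsPlanar := by
  classical
  have : Nontrivial V := ⟨a, b, D.adj_ab.ne⟩
  have : Nontrivial W := ⟨x, y, D.adj_xy.ne⟩
  have : Nontrivial (V ⊕ {w : W | w ≠ x ∧ w ≠ y}) :=
    ⟨Sum.inl a, Sum.inl b, by simpa using D.adj_ab.ne⟩
  have : Finite {e : H.Dart // e.fst ≠ x ∧ e.fst ≠ y} := Subtype.finite
  refine ⟨D.rotationSystem RG RH, ?_⟩
  rw [RotationSystem.isPlane_iff_of_connected _ hKc]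
  rw [RG.isPlane_iff_of_connected hGc] at hG
  rw [RH.isPlane_iff_of_connected hHc] at hH
  have h1 := (D.rotationSystem RG RH).card_add_card_face_le
  have h2 : Nat.card (G.dotProduct H a b c d x y a' b' c' d').ConnectedComponent = 1 := by
    have := hKc.preconnected.subsingleton_connectedComponent
    have := hKc.nonempty
    rw [Nat.card_eq_one_iff_unique]
    exact ⟨inferInstance, inferInstance⟩
  rw [h2, RotationSystem.card_face, D.cycleCount_faceStep] at h1
  rw [D.cycleCount_faceStep]
  have h3 := hRH.cycleCount_add_le RG
  have h4 : (dotNext RG RH x y * D.factorPerm).SameCycle (Sum.inl ⟨(a, b), D.adj_ab⟩)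
      (Sum.inl ⟨(c, d), D.adj_cd⟩) :=
    hface.map _ (fun e => (D.dotNext_factorPerm_inl RG RH e).symm)
  have h5 := cycleCount_mul_unsplice_le (dotNext RG RH x y) D.reversal
    (by simpa using fun h => absurd h D.ne_ac) h4
  have h6 := D.card_edgeSet hx hy
  have h7 := card_dotProduct_vertices (V := V) D.adj_xy.ne
  rw [IsDotData.factorPerm] at h3
  omega

end DotProductPlanar

/-! ### Choice of the labelling and the main theorem -/

section MainTheorem

open Equiv Equiv.Perm

variable {V W : Type*} {G : SimpleGraph V} {H : SimpleGraph W} {a b c d : V}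
  {x y a' b' c' d' : W}

/-- The rotation at a cubic vertex. -/
lemma RotationSystem.exists_next_of_isCubicVertex [Finite W] (RH : H.RotationSystem)
    (hx : H.IsCubicVertex x) (hxy : H.Adj x y) :
    ∃ (p q : W) (hp : H.Adj x p) (hq : H.Adj x q), p ≠ q ∧ p ≠ y ∧ q ≠ y ∧
      H.neighborSet x = {p, q, y} ∧ RH.next ⟨(x, y), hxy⟩ = ⟨(x, p), hp⟩ ∧
      RH.next ⟨(x, p), hp⟩ = ⟨(x, q), hq⟩ ∧ RH.next ⟨(x, q), hq⟩ = ⟨(x, y), hxy⟩ := by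
  have hex : ∀ e : H.Dart, e.fst = x → ∃ (p : W) (hp : H.Adj x p), RH.next e = ⟨(x, p), hp⟩ := by
    intro e he
    have h1 := RH.next_fst e
    rw [he] at h1
    generalize RH.next e = f at h1
    obtain ⟨⟨u, p⟩, hp⟩ := f
    obtain rfl : u = x := h1
    exact ⟨p, hp, rfl⟩
  obtain ⟨p, hp, h0⟩ := hex ⟨(x, y), hxy⟩ rfl
  obtain ⟨q, hq, h1⟩ := hex ⟨(x, p), hp⟩ rfl
  obtain ⟨r, hr, h2⟩ := hex ⟨(x, q), hq⟩ rfl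
  have hsame : ∀ {w} (hw : H.Adj x w), RH.next.SameCycle ⟨(x, y), hxy⟩ ⟨(x, w), hw⟩ :=
    fun hw => (RH.sameCycle_iff _ _).2 rfl
  have hinj : ∀ {u v} (hu : H.Adj x u) (hv : H.Adj x v),
      RH.next ⟨(x, u), hu⟩ = RH.next ⟨(x, v), hv⟩ → u = v := by
    intro u v hu hv h
    simpa using RH.next.injective h
  have hcongr : ∀ {u v} (hu : H.Adj x u) (hv : H.Adj x v), u = v →
      (⟨(x, u), hu⟩ : H.Dart) = ⟨(x, v), hv⟩ := by
    rintro u v hu hv rfl; rfl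
  -- The rotation at `x` is one cycle through three darts. If it closed up after one or two steps,
  -- all neighbours of `x` would lie in a set of two.
  have hcard : ∀ u v : W, ¬ H.neighborSet x ⊆ {u, v} := by
    intro u v h
    have h3 := Set.ncard_le_ncard h (Set.toFinite _)
    have h4 := Set.ncard_insert_le u {v}
    rw [Set.ncard_singleton] at h4
    rw [hx] at h3
    omega
  have hqy : q ≠ y := by
    intro hqy
    apply hcard p y
    intro w hw
    have := (hsame hw).mem_of_forall (S := {⟨(x, p), hp⟩, ⟨(x, y), hxy⟩}) (by
      rintro e (rfl | rfl)
      · rw [h1]; exact Or.inr (hcongr _ _ hqy)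
      · rw [h0]; exact Or.inl rfl) (Or.inr rfl)
    exact this.imp (congrArg fun e : H.Dart => e.snd) (congrArg fun e : H.Dart => e.snd)
  have hpy : p ≠ y := by
    intro hpy
    apply hcard p y
    intro w hw
    have := (hsame hw).mem_of_forall (S := {⟨(x, y), hxy⟩}) (by
      rintro e rfl
      rw [h0]; exact hcongr _ _ hpy) rfl
    exact Or.inr (congrArg (fun e : H.Dart => e.snd) this)
  have hpq : p ≠ q := by
    intro hpq
    exact hpy (hinj hp hxy (by rw [h0, h1]; exact hcongr _ _ hpq.symm))
  have hN : H.neighborSet x = {p, q, y} := by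
    symm
    refine Set.eq_of_subset_of_ncard_le ?_ ?_ (Set.toFinite _)
    · rintro w (rfl | rfl | rfl) <;> assumption
    · rw [hx, Set.ncard_eq_three.2 ⟨p, q, y, hpq, hpy, hqy, rfl⟩]
  refine ⟨p, q, hp, hq, hpq, hpy, hqy, hN, h0, h1, ?_⟩
  rw [h2]
  apply hcongr
  have hr' : r ∈ ({p, q, y} : Set W) := hN ▸ hr
  rcases hr' with rfl | rfl | rfl
  · exact absurd (hinj hq hxy (by rw [h2, h0])) hqy
  · exact absurd (hinj hq hp (by rw [h2, h1])) hpq.symm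
  · rfl

/-- Renaming the ends of a deleted edge together with their partners changes nothing. This allows
the edges to be oriented as the common facial walk traverses them. -/
lemma dotProduct_swap_left : G.dotProduct H b a c d x y b' a' c' d' =
    G.dotProduct H a b c d x y a' b' c' d' := by
  ext (u | u) (v | v)
  · rw [dotProduct_adj_inl_inl, dotProduct_adj_inl_inl, Sym2.eq_swap (a := b)]
  · rw [dotProduct_adj_inl_inr, dotProduct_adj_inl_inr]; tauto
  · rw [dotProduct_adj_inr_inl, dotProduct_adj_inr_inl]; tauto
  · rw [dotProduct_adj_inr_inr, dotProduct_adj_inr_inr]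

lemma dotProduct_swap_right : G.dotProduct H a b d c x y a' b' d' c' =
    G.dotProduct H a b c d x y a' b' c' d' := by
  ext (u | u) (v | v)
  · rw [dotProduct_adj_inl_inl, dotProduct_adj_inl_inl, Sym2.eq_swap (a := d)]
  · rw [dotProduct_adj_inl_inr, dotProduct_adj_inl_inr]; tauto
  · rw [dotProduct_adj_inr_inl, dotProduct_adj_inr_inl]; tauto
  · rw [dotProduct_adj_inr_inr, dotProduct_adj_inr_inr]

lemma AreOtherNeighbors.swap_left (h : H.AreOtherNeighbors x y a' b' c' d') :
    H.AreOtherNeighbors x y b' a' c' d' :=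
  ⟨by rw [h.1, Set.insert_comm], h.2⟩

lemma AreOtherNeighbors.swap_right (h : H.AreOtherNeighbors x y a' b' c' d') :
    H.AreOtherNeighbors x y a' b' d' c' :=
  ⟨h.1, by rw [h.2, Set.insert_comm]⟩

lemma ne_of_ncard_eq_three {u v w : W} (h : ({u, v, w} : Set W).ncard = 3) :
    u ≠ v ∧ u ≠ w ∧ v ≠ w := by
  have h2 : ∀ p q : W, ({p, q} : Set W).ncard ≤ 2 := fun p q => by
    have := Set.ncard_insert_le p {q}
    rwa [Set.ncard_singleton] at this
  refine ⟨?_, ?_, ?_⟩ <;> rintro rfl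
  · have := h2 u w
    simp_all
  · have := h2 u v
    rw [Set.insert_comm, Set.pair_eq_singleton, Set.pair_comm] at h
    omega
  · have := h2 u v
    simp_all

/-- A hamiltonian path from `c` to `a` on the left continues along `aa'` through all of the right
side. -/
lemma AreOtherNeighbors.connected_dotProduct (hN : H.AreOtherNeighbors x y a' b' c' d')
    (hxy : H.Adj x y) (hH : H.HasCycleOn {u | u ≠ y})
    (hca : (G.deleteEdges {s(a, b), s(c, d)}).HasPathOn Set.univ c a) :
    (G.dotProduct H a b c d x y a' b' c' d').Connected := by
  have h1 := hca.dotProduct_inl (H := H) (x := x) (y := y) (a' := a') (b' := b') (c' := c')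
    (d' := d')
  have h2 := (hN.hasPathOn hxy hH).dotProduct_inr (G := G) (a := a) (b := b) (c := c) (d := d)
    (a' := a') (b' := b') (c' := c') (d' := d') subset_rfl
  have h3 := h1.append h2 (dotProduct_adj_inl_inr.2 (by simp)) (disjoint_image_inl_image_inr _ _)
  have h4 : (Sum.inl '' Set.univ ∪ Sum.inr '' (Subtype.val ⁻¹' {w | w ≠ x ∧ w ≠ y}) :
      Set (V ⊕ {w : W | w ≠ x ∧ w ≠ y})) = Set.univ := by
    ext z
    rcases z with u | w
    · simp
    · simp only [Set.mem_union, Set.mem_image, Set.mem_univ, iff_true]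
      exact Or.inr ⟨w, w.2, rfl⟩
  rw [h4] at h3
  exact h3.connected

lemma AreOtherNeighbors.connected (hN : H.AreOtherNeighbors x y a' b' c' d')
    (hxy : H.Adj x y) (hH : H.HasCycleOn {u | u ≠ y}) : H.Connected := by
  have h1 := (hN.hasPathOn hxy hH).symm.append (hasPathOn_singleton x)
    (hN.adj_left.2 (Or.inl rfl)).symm (by simp)
  have h2 := h1.append (hasPathOn_singleton y) hxy (by simp [hxy.ne'])
  have h3 : {u | u ≠ x ∧ u ≠ y} ∪ {x} ∪ {y} = Set.univ := by ext; simp; tauto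
  rw [h3] at h2
  exact h2.connected

/-- The labelling is read off from the embedding of `H`: the other neighbours of `x` and of `y` are
named in the order in which they follow the edge `xy` in the two rotations. -/
lemma exists_isPlanar_dotProduct [Finite V] [Finite W] {RG : G.RotationSystem} (hG : RG.IsPlane)
    (hab : G.Adj a b) (hcd : G.Adj c d) (hac : a ≠ c) (had : a ≠ d) (hbc : b ≠ c) (hbd : b ≠ d)
    (hface : RG.faceStep.SameCycle ⟨(a, b), hab⟩ ⟨(c, d), hcd⟩)
    (hca : (G.deleteEdges {s(a, b), s(c, d)}).HasPathOn Set.univ c a)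
    (hxy : H.Adj x y) (hx : H.IsCubicVertex x) (hy : H.IsCubicVertex y)
    (hH : H.HasCycleOn {u | u ≠ y}) (hplanar : H.IsPlanar) :
    ∃ a' b' c' d' : W, H.AreOtherNeighbors x y a' b' c' d' ∧
        (G.dotProduct H a b c d x y a' b' c' d').IsPlanar := by
  obtain ⟨RH, hRH⟩ := hplanar
  obtain ⟨p, q, hp, hq, hpq, hpy, hqy, hNx, h1, h2, h3⟩ := RH.exists_next_of_isCubicVertex hx hxy
  obtain ⟨r, s, hr, hs, hrs, hrx, hsx, hNy, k1, k2, k3⟩ :=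
    RH.exists_next_of_isCubicVertex hy hxy.symm
  have hN : H.AreOtherNeighbors x y p q r s := ⟨hNx, hNy⟩
  let D : IsDotData G H a b c d x y p q r s :=
    ⟨hab, hcd, hac, had, hbc, hbd, hxy, hN, hpq, hrs, hpy, hqy, hrx, hsx⟩
  have hD : D.IsAligned RH := ⟨h1, h2, h3, k1, k2, k3⟩
  exact ⟨p, q, r, s, hN, hD.isPlanar hG hRH hface hx hy
    (hca.mono (deleteEdges_le _)).connected (hN.connected hxy hH)
    (hN.connected_dotProduct hxy hH hca)⟩

end MainTheorem

end SimpleGraph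

open scoped Classical in
theorem mainTheorem2 {V W : Type*} [Fintype V] [Fintype W]
    (G : SimpleGraph V) (H : SimpleGraph W)
    -- the graph `G` with its independent edges `ab` and `cd`
    (a b c d : V)
    (hG : ¬ G.IsHamiltonian)
    (hab : G.Adj a b) (hcd : G.Adj c d)
    (hac : a ≠ c) (had : a ≠ d) (hbc : b ≠ c) (hbd : b ≠ d)
    -- condition (i)
    (hi_ac : (G.deleteEdges {s(a, b), s(c, d)}).IsGoodPair a c)
    (hi_ad : (G.deleteEdges {s(a, b), s(c, d)}).IsGoodPair a d)
    (hi_bc : (G.deleteEdges {s(a, b), s(c, d)}).IsGoodPair b c)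
    (hi_bd : (G.deleteEdges {s(a, b), s(c, d)}).IsGoodPair b d)
    (hi_abcd : (G.deleteEdges {s(a, b), s(c, d)}).IsGoodPairOfPairs a b c d)
    -- condition (ii)
    (hii : ∀ v : V,
      (G.deleteEdges {s(a, b), s(c, d)}).IsGoodPairAfterDelete v a b ∨
      (G.deleteEdges {s(a, b), s(c, d)}).IsGoodPairAfterDelete v c d)
    -- the graph `H` with its adjacent cubic vertices `x` and `y`
    (x y : W)
    (hH : H.IsHypohamiltonian)
    (hxy : H.Adj x y) (hx : H.IsCubicVertex x) (hy : H.IsCubicVertex y) :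
    -- every way of forming the dot product
    (∀ a' b' c' d' : W, H.AreOtherNeighbors x y a' b' c' d' →
      (G.dotProduct H a b c d x y a' b' c' d').IsHypohamiltonian ∧
      min G.egirth H.egirth ≤ (G.dotProduct H a b c d x y a' b' c' d').egirth ∧
      (G.IsCubic → H.IsCubic → (G.dotProduct H a b c d x y a' b' c' d').IsCubic)) ∧
    -- in the planar case, some way of forming the dot product is planar
    ((∃ R : G.RotationSystem, R.IsPlane ∧ R.OnCommonFace s(a, b) s(c, d)) → H.IsPlanar →
      ∃ a' b' c' d' : W, H.AreOtherNeighbors x y a' b' c' d' ∧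
        (G.dotProduct H a b c d x y a' b' c' d').IsPlanar) := by
  have hi_ac := hi_ac.hasPathOn
  have hi_ad := hi_ad.hasPathOn
  have hi_bc := hi_bc.hasPathOn
  have hi_bd := hi_bd.hasPathOn
  have hi_abcd := hi_abcd.exists_hasPathOn
  have hii := fun v => (hii v).imp SimpleGraph.IsGoodPairAfterDelete.hasPathOn
    SimpleGraph.IsGoodPairAfterDelete.hasPathOn
  have hW := hx.four_le_card
  have hHc := hH.hasCycleOn (by omega)
  have hab' := hab.ne
  have hcd' := hcd.ne
  refine ⟨fun a' b' c' d' hN => ?_, ?_⟩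
  · have hx' := hx
    have hy' := hy
    rw [SimpleGraph.IsCubicVertex, hN.1] at hx'
    rw [SimpleGraph.IsCubicVertex, hN.2] at hy'
    obtain ⟨ne_ab', ne_ya', ne_yb'⟩ := SimpleGraph.ne_of_ncard_eq_three hx'
    obtain ⟨ne_cd', ne_xc', ne_xd'⟩ := SimpleGraph.ne_of_ncard_eq_three hy'
    have D : SimpleGraph.IsDotData G H a b c d x y a' b' c' d' :=
      ⟨hab, hcd, hac, had, hbc, hbd, hxy, hN, ne_ab', ne_cd', ne_ya', ne_yb', ne_xc', ne_xd'⟩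
    have hcycle := fun S => SimpleGraph.HasCycleOn.of_dotProduct (S := S) hab hcd hac had hbc hbd
      hxy hN ⟨a', D.adj_xa'.ne', ne_ya'⟩
    refine ⟨SimpleGraph.isHypohamiltonian_of_hasCycleOn ?_ ?_ ?_, ?_, D.isCubic⟩
    · have : Nontrivial (V ⊕ {w : W | w ≠ x ∧ w ≠ y}) :=
        ⟨Sum.inl a, Sum.inl b, by simpa using hab'⟩
      exact Finite.one_lt_card.ne'
    · intro h
      rcases hcycle _ h with ⟨T, hT, -, hu⟩ | ⟨T, hT, -, hu⟩
      · rw [hu rfl] at hT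
        exact hG hT.hamiltonian
      · rw [hu rfl] at hT
        exact hH.1 hT.hamiltonian
    · rintro (v | w)
      · exact SimpleGraph.hasCycleOn_dotProduct_delete_inl hab' hcd' hxy hN hHc v (hii v)
      · exact SimpleGraph.hasCycleOn_dotProduct_delete_inr hab' hac had hbc hbd hi_ac hi_ad hi_bc
          hi_bd hi_abcd hxy hN hHc w
    · refine SimpleGraph.min_egirth_le_of_forall_hasCycleOn fun S hS => ?_
      exact (hcycle S hS).imp (fun ⟨T, h1, h2, _⟩ => ⟨T, h1, h2⟩)
        (fun ⟨T, h1, h2, _⟩ => ⟨T, h1, h2⟩)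
  · rintro ⟨R, hR, d₁, d₂, h₁, h₂, hface⟩ hHp
    rw [SimpleGraph.dart_edge_eq_mk'_iff] at h₁ h₂
    obtain ⟨⟨u, v⟩, huv⟩ := d₁
    obtain ⟨⟨u', v'⟩, huv'⟩ := d₂
    simp only [Prod.mk.injEq] at h₁ h₂
    -- The common facial walk may traverse each of the two edges in either direction. Each case is
    -- brought to the standard orientation by exchanging names, with the hamiltonian path of
    -- condition (i) that fits it.
    rcases h₁ with ⟨rfl, rfl⟩ | ⟨rfl, rfl⟩ <;> rcases h₂ with ⟨rfl, rfl⟩ | ⟨rfl, rfl⟩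
    · exact SimpleGraph.exists_isPlanar_dotProduct hR huv huv' hac had hbc hbd hface hi_ac.symm
        hxy hx hy (hHc y) hHp
    · rw [Sym2.eq_swap (a := v')] at hi_ad
      obtain ⟨a', b', c', d', hN, h⟩ := SimpleGraph.exists_isPlanar_dotProduct hR huv huv' had hac
        hbd hbc hface hi_ad.symm hxy hx hy (hHc y) hHp
      exact ⟨a', b', d', c', hN.swap_right, by rwa [SimpleGraph.dotProduct_swap_right]⟩
    · rw [Sym2.eq_swap (a := v)] at hi_bc
      obtain ⟨a', b', c', d', hN, h⟩ := SimpleGraph.exists_isPlanar_dotProduct hR huv huv' hbc hbd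
        hac had hface hi_bc.symm hxy hx hy (hHc y) hHp
      exact ⟨b', a', c', d', hN.swap_left, by rwa [SimpleGraph.dotProduct_swap_left]⟩
    · rw [Sym2.eq_swap (a := v), Sym2.eq_swap (a := v')] at hi_bd
      obtain ⟨a', b', c', d', hN, h⟩ := SimpleGraph.exists_isPlanar_dotProduct hR huv huv' hbd hbc
        had hac hface hi_bd.symm hxy hx hy (hHc y) hHp
      exact ⟨b', a', d', c', hN.swap_left.swap_right, by
        rwa [SimpleGraph.dotProduct_swap_left, SimpleGraph.dotProduct_swap_right]⟩
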